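/- Let $n\ge 0$, let $B_n$ be the group and $B_n^+$ the monoid given by the generators $\sigma_1,\dots,\sigma_{n-1}$ and the relations $\sigma_j\sigma_i=\sigma_i\sigma_j$ for $|i-j|>1$ and $\sigma_i\sigma_j\sigma_i=\sigma_j\sigma_i\sigma_j$ for $|i-j|=1$; elements of $B_n$ are called $n$-braids. For $x,y\in B_n^+$ write $x\prec y$ if $xz=y$ for some $z\in B_n^+$, and let $x\wedge y$ be the greatest common lower bound of $x$ and $y$ with respect to $\prec$. Put $\Delta=(\sigma_1\cdots\sigma_{n-1})(\sigma_1\cdots\sigma_{n-2})\cdots(\sigma_1\sigma_2)\sigma_1$, let $\tau$ be the involution with $\tau(\sigma_i)=\sigma_{n-i}$, and let $S_n=\{x\in B_n^+ : x\prec\Delta\}$. For $a\in S_n$ let $a^*=a^{-1}\Delta\in B_n^+$, and for $b\in B_n^+$ write $a\lceil b$ if $a^*\wedge b=e$, where $e$ is the identity. Every $x\in B_n$ has a weighted form $x=\Delta^u x_1x_2\cdots x_k$ with $u\in\mathbb Z$, $x_i\in S_n\setminus\{e,\Delta\}$ for all $i$ and $x_i\lceil x_{i+1}$ for $1\le i<k$;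 it is unique for $n\ge 2$. The number $\ell(x)=k$ is the canonical length of $x$. The cycling and the decycling of $x$ are $$\mathbf c(x)=\tau^u(x_1)^{-1}\,x\,\tau^u(x_1),\qquad \mathbf d(x)=x_k\,x\,x_k^{-1}$$ if $k\ge 1$, and $\mathbf c(x)=\mathbf d(x)=x$ if $k=0$. The braid $x$ is cyclically weighted if $k\ge 1$ and $x_k\lceil\tau^u(x_1)$. The reduced super summit set $RSSS(x)$ is the set of all conjugates $y$ of $x$ in $B_n$ such that $\mathbf c^M(y)=y=\mathbf d^N(y)$ for some positive integers $M,N$. Let $x$ be an $n$-braid. If $x$ is cyclically weighted and $\ell(x)\ge 2$, then every braid in $RSSS(x)$ is cyclically weighted. -/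

import Mathlib

namespace BraidTheory

/-- Artin's relations on the generators `σ_0, …, σ_{n-2}` (indexed from zero), as pairs of positive
words: `σ_j σ_i = σ_i σ_j` for `|i - j| > 1` and `σ_i σ_j σ_i = σ_j σ_i σ_j` for `|i - j| = 1`. -/
inductive ArtinRel (n : ℕ) : FreeMonoid (Fin (n - 1)) → FreeMonoid (Fin (n - 1)) → Prop
  | far (i j : Fin (n - 1)) (h : 1 < |((i : ℕ) : ℤ) - ((j : ℕ) : ℤ)|) :
      ArtinRel n (FreeMonoid.of j * FreeMonoid.of i) (FreeMonoid.of i * FreeMonoid.of j)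
  | near (i j : Fin (n - 1)) (h : |((i : ℕ) : ℤ) - ((j : ℕ) : ℤ)| = 1) :
      ArtinRel n (FreeMonoid.of i * FreeMonoid.of j * FreeMonoid.of i)
        (FreeMonoid.of j * FreeMonoid.of i * FreeMonoid.of j)

/-- The monoid `B_n^+` of positive `n`-braids: the monoid with Artin's presentation. -/
abbrev PosBraid (n : ℕ) : Type := PresentedMonoid (ArtinRel n)

/-- The relators `v w⁻¹` of the braid group, one for each of Artin's relations `v = w`. -/
def artinRelators (n : ℕ) : Set (FreeGroup (Fin (n - 1))) :=
  {r | ∃ v w : FreeMonoid (Fin (n - 1)), ArtinRel n v w ∧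
    r = FreeMonoid.lift FreeGroup.of v * (FreeMonoid.lift FreeGroup.of w)⁻¹}

/-- The braid group `B_n` on `n` strands: the group with Artin's presentation. -/
abbrev Braid (n : ℕ) : Type := PresentedGroup (artinRelators n)

/-- The generator `σ_i` as a positive braid. -/
def sigma {n : ℕ} (i : Fin (n - 1)) : PosBraid n := PresentedMonoid.of (ArtinRel n) i

/-- Two words that agree by one of Artin's relations have the same value in the braid group. -/
theorem artinRel_group {n : ℕ} (v w : FreeMonoid (Fin (n - 1))) (h : ArtinRel n v w) :
    FreeMonoid.lift (fun i : Fin (n - 1) => (PresentedGroup.of i : Braid n)) v =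
      FreeMonoid.lift (fun i : Fin (n - 1) => (PresentedGroup.of i : Braid n)) w := by
  have key : ∀ v : FreeMonoid (Fin (n - 1)),
      FreeMonoid.lift (fun i : Fin (n - 1) => (PresentedGroup.of i : Braid n)) v =
        PresentedGroup.mk (artinRelators n) (FreeMonoid.lift FreeGroup.of v) := by
    intro v
    have h2 : FreeMonoid.lift (fun i : Fin (n - 1) => (PresentedGroup.of i : Braid n)) =
        (PresentedGroup.mk (artinRelators n)).comp (FreeMonoid.lift FreeGroup.of) := by
      apply FreeMonoid.hom_eq
      intro i
      rfl
    exact DFunLike.congr_fun h2 v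
  rw [key, key, ← mul_inv_eq_one, ← map_inv, ← map_mul]
  exact PresentedGroup.one_of_mem ⟨v, w, h, rfl⟩

/-- The canonical homomorphism `B_n^+ → B_n`, sending `σ_i` to `σ_i`. -/
def toBraid (n : ℕ) : PosBraid n →* Braid n :=
  PresentedMonoid.lift (fun i : Fin (n - 1) => (PresentedGroup.of i : Braid n)) artinRel_group

/-- Artin's relations are preserved by the reflection of the indices (in one-based indexing,
`i ↦ n - i`). -/
theorem artinRel_rev {n : ℕ} (v w : FreeMonoid (Fin (n - 1))) (h : ArtinRel n v w) :
    FreeMonoid.lift (fun i : Fin (n - 1) => (sigma i.rev : PosBraid n)) v =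
      FreeMonoid.lift (fun i : Fin (n - 1) => (sigma i.rev : PosBraid n)) w := by
  have habs : ∀ i j : Fin (n - 1), |((i.rev : ℕ) : ℤ) - ((j.rev : ℕ) : ℤ)| =
      |((i : ℕ) : ℤ) - ((j : ℕ) : ℤ)| := by
    intro i j
    have hi := i.isLt
    have hj := j.isLt
    have e : ((i.rev : ℕ) : ℤ) - ((j.rev : ℕ) : ℤ) = -(((i : ℕ) : ℤ) - ((j : ℕ) : ℤ)) := by
      rw [Fin.val_rev, Fin.val_rev]
      omega
    rw [e, abs_neg]
  cases h with
  | far i j h =>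
    have h2 := (Con.eq (conGen (ArtinRel n))).mpr
      (ConGen.Rel.of _ _ (ArtinRel.far i.rev j.rev (by rw [habs]; exact h)))
    simp only [map_mul, FreeMonoid.lift_eval_of]
    exact h2
  | near i j h =>
    have h2 := (Con.eq (conGen (ArtinRel n))).mpr
      (ConGen.Rel.of _ _ (ArtinRel.near i.rev j.rev (by rw [habs]; exact h)))
    simp only [map_mul, FreeMonoid.lift_eval_of]
    exact h2

/-- The flip `σ_i ↦ σ_{n-i}` (in one-based indexing), as a homomorphism of `B_n^+`. -/
def flipHom (n : ℕ) : PosBraid n →* PosBraid n :=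
  PresentedMonoid.lift (fun i : Fin (n - 1) => (sigma i.rev : PosBraid n)) artinRel_rev

theorem flipHom_comp_flipHom (n : ℕ) :
    (flipHom n).comp (flipHom n) = MonoidHom.id (PosBraid n) := by
  apply PresentedMonoid.ext
  intro i
  simp [flipHom, sigma]

/-- The involution `τ` with `τ(σ_i) = σ_{n-i}` (in one-based indexing), as an automorphism of
`B_n^+`. Its integer powers are taken in the automorphism group. -/
def tau (n : ℕ) : MulAut (PosBraid n) :=
  MonoidHom.toMulEquiv (flipHom n) (flipHom n) (flipHom_comp_flipHom n) (flipHom_comp_flipHom n)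

/-- `x ≺ y`: the positive braid `x` is a left subword of `y`. -/
def LeftSubword {n : ℕ} (x y : PosBraid n) : Prop := ∃ z : PosBraid n, x * z = y

/-- `m` is the (left) meet `x ∧ y`: the greatest common left subword of `x` and `y`. -/
def IsMeet {n : ℕ} (x y m : PosBraid n) : Prop :=
  LeftSubword m x ∧ LeftSubword m y ∧
    ∀ z : PosBraid n, LeftSubword z x → LeftSubword z y → LeftSubword z m

/-- The product `σ_0 σ_1 ⋯ σ_{k-1}` of the first `k` generators. -/
def sigmaRow (n k : ℕ) : PosBraid n := (((List.finRange (n - 1)).take k).map sigma).prod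

/-- The fundamental braid `Δ = (σ_1 ⋯ σ_{n-1}) (σ_1 ⋯ σ_{n-2}) ⋯ (σ_1 σ_2) σ_1` (in one-based
indexing). -/
def fundamental (n : ℕ) : PosBraid n := ((List.range n).reverse.map (sigmaRow n)).prod

/-- The set `S_n` of permutation braids. -/
def permBraids (n : ℕ) : Set (PosBraid n) := {x | LeftSubword x (fundamental n)}

/-- `c` is the right complement `a^* = a⁻¹ Δ` of `a`. -/
def IsRightComplement {n : ℕ} (a c : PosBraid n) : Prop := a * c = fundamental n

/-- `a ⌈ b`: `a` is a permutation braid, and `a^* ∧ b = e`. -/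
def Weighted {n : ℕ} (a b : PosBraid n) : Prop :=
  a ∈ permBraids n ∧ ∃ c : PosBraid n, IsRightComplement a c ∧ IsMeet c b 1

/-- `x = Δ^u x_1 ⋯ x_k`, with `l = [x_1, …, x_k]`, is a weighted form of `x`. -/
structure IsWeightedForm {n : ℕ} (x : Braid n) (u : ℤ) (l : List (PosBraid n)) : Prop where
  eq_prod : x = toBraid n (fundamental n) ^ u * toBraid n l.prod
  mem_permBraids : ∀ a ∈ l, a ∈ permBraids n
  ne_one : ∀ a ∈ l, a ≠ 1
  ne_fundamental : ∀ a ∈ l, a ≠ fundamental n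
  weighted : l.IsChain Weighted

open Classical in
/-- The weighted form of a braid, as the pair of the exponent of `Δ` and the list of factors.
Every braid has a weighted form, which is unique for `n ≥ 2`; the default is never taken.
(For `n ≤ 1` the group is trivial and the list of factors is empty.) -/
noncomputable def weightedForm {n : ℕ} (x : Braid n) : ℤ × List (PosBraid n) :=
  if h : ∃ p : ℤ × List (PosBraid n), IsWeightedForm x p.1 p.2 then h.choose else (0, [])

/-- The infimum `inf(x)`. -/
noncomputable def infimum {n : ℕ} (x : Braid n) : ℤ := (weightedForm x).1

/-- The factors `x_1, …, x_k` of the weighted form of `x`. -/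
noncomputable def factors {n : ℕ} (x : Braid n) : List (PosBraid n) := (weightedForm x).2

/-- The canonical length `ℓ(x)`. -/
noncomputable def canonicalLength {n : ℕ} (x : Braid n) : ℕ := (factors x).length

/-- The head `H(x) = x_1`, by convention `e` if there are no factors. -/
noncomputable def head {n : ℕ} (x : Braid n) : PosBraid n := (factors x).headD 1

/-- The tail `T(x) = x_k`, by convention `e` if there are no factors. -/
noncomputable def tail {n : ℕ} (x : Braid n) : PosBraid n := (factors x).getLastD 1

/-- The initial factor carried to the end of the braid, `τ^u(x_1)` with `u = inf(x)`. -/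
noncomputable def twistedHead {n : ℕ} (x : Braid n) : PosBraid n := (tau n ^ infimum x) (head x)

/-- Cycling: `c(x) = τ^u(H(x))⁻¹ x τ^u(H(x))`. -/
noncomputable def cycling {n : ℕ} (x : Braid n) : Braid n :=
  (toBraid n (twistedHead x))⁻¹ * x * toBraid n (twistedHead x)

/-- Decycling: `d(x) = T(x) x T(x)⁻¹`. -/
noncomputable def decycling {n : ℕ} (x : Braid n) : Braid n :=
  toBraid n (tail x) * x * (toBraid n (tail x))⁻¹

/-- `x = Δ^u x_1 ⋯ x_k` is cyclically weighted: `k ≥ 1` and `x_k ⌈ τ^u(x_1)`. -/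
def CyclicallyWeighted {n : ℕ} (x : Braid n) : Prop :=
  factors x ≠ [] ∧ Weighted (tail x) (twistedHead x)

/-- The reduced super summit set `RSSS(x)`: the conjugates `y` of `x` such that
`c^M(y) = y = d^N(y)` for some positive integers `M` and `N`. -/
def RSSS {n : ℕ} (x : Braid n) : Set (Braid n) :=
  {y | IsConj x y ∧ ∃ M N : ℕ, 0 < M ∧ 0 < N ∧ cycling^[M] y = y ∧ decycling^[N] y = y}

end BraidTheory

/-!
The argument takes place in a Garside group `G`: a group with a left-invariant order `a ≤ b`, given
by `a⁻¹ b` being positive, which has meets, and with a Garside element `Δ`. For an exponent `u` put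
`init u g = g Δ⁻ᵘ ∧ Δ`, and let `cyc u` be the conjugation of `g` by `init u g`; if `u` is the
infimum of `g`, this is cycling. Let `orb u g j` be the product of the first `j` conjugating
elements along the orbit of `g`.

Up to powers of `Δ`, the element `orb u g j` is the meet of the powers `gⁱ` with `i ≤ j`
(`le_orb_iff`). Two consequences carry the proof.
* A positive `s ≤ Δʳ` with `g s = s h` is transported by iterated cycling of `g` and `h` to positive
  elements, which are again at most `Δʳ` (`orb_transport`). There are finitely many of them, so if
  `g` and `h` are periodic under cycling, some conjugating element is fixed by the transport along a
  common period (`exists_periodic_transport`). Comparing weights shows that a periodic element has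
  the largest infimum of its conjugacy class (`zpow_succ_le_of_conj`). Decycling of `g` is
  essentially cycling of `g⁻¹`, so the same lemma bounds the supremum.
* If `g` is periodic under cycling, then only the extreme terms of the meet matter:
  `orb u g j = gʲ Δ⁻ʲᵘ ∧ Δʲ` (`le_orb_of_periodic`).

Let `x` be rigid of length `k ≥ 2` and infimum `u`, and let `y` be a conjugate that is periodic
under cycling and decycling. Then `y` has the infimum of `x`, and its length is at most `k`. For
rigid `x`, cycling rotates the factors, so `orb u x (k m) = xᵐ Δ⁻ᵘᵐ`; a fixed conjugating element
turns this into `orb u y (k m) = yᵐ Δ⁻ᵘᵐ` for some `m > 0`. By the second point, the first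
`k m` factors of `yᵐ⁺¹` are therefore those of `yᵐ`, and cancelling `yᵐ⁻¹` shows that the first `k`
factors of `y²` are those of `y` (`le_of_le_sq`). Were the last and the first factor of `y` not
weighted, then the last factor could be enlarged within `y²`, a contradiction
(`wrapsAround_of_conj`).

That the braid group is a Garside group rests on Garside's theorem that the common right multiples
of two generators are the multiples of the one given by their defining relation
(`sigmaSplit_of_eq`), which gives left cancellation and meets (`exists_isMeet`). The properties of
`Δ` then give common multiples and right cancellation, and the positive monoid embeds in its group
of fractions, hence in the braid group (`toBraid_injective`).
-/

namespace BraidTheory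

/-! ### Length, and cancellation of generators in the positive monoid -/

variable {n : ℕ}

/-- The length of a positive braid, as a multiplicative homomorphism. -/
def lenHom (n : ℕ) : PosBraid n →* Multiplicative ℕ :=
  PresentedMonoid.lift (fun _ => Multiplicative.ofAdd 1) (by
    intro v w h
    cases h <;> simp [map_mul])

/-- The length of a positive braid: the number of letters of any word representing it. -/
def len (x : PosBraid n) : ℕ := (lenHom n x).toAdd

@[simp] theorem len_one : len (1 : PosBraid n) = 0 := by simp [len]

@[simp] theorem len_mul (x y : PosBraid n) : len (x * y) = len x + len y := by simp [len]

@[simp] theorem len_sigma (i : Fin (n - 1)) : len (sigma i) = 1 := by simp [len, lenHom, sigma]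

theorem mk_of (i : Fin (n - 1)) :
    PresentedMonoid.mk (ArtinRel n) (FreeMonoid.of i) = sigma i := rfl

theorem eq_one_or_eq_sigma_mul (x : PosBraid n) : x = 1 ∨ ∃ i y, x = sigma i * y := by
  obtain ⟨w, rfl⟩ := PresentedMonoid.surjective_mk x
  induction w using FreeMonoid.casesOn with
  | one => exact .inl rfl
  | of_mul i v => exact .inr ⟨i, PresentedMonoid.mk _ v, by rw [map_mul, mk_of]⟩

theorem sigma_mul_induction {p : PosBraid n → Prop} (one : p 1)
    (mul : ∀ i x, p x → p (sigma i * x)) (x : PosBraid n) : p x := by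
  obtain ⟨w, rfl⟩ := PresentedMonoid.surjective_mk x
  induction w using FreeMonoid.inductionOn' with
  | one => exact one
  | of_mul i v ih => rw [map_mul]; exact mul _ _ ih

theorem len_eq_zero {x : PosBraid n} : len x = 0 ↔ x = 1 := by
  constructor
  · intro h
    rcases eq_one_or_eq_sigma_mul x with rfl | ⟨i, y, rfl⟩
    · rfl
    · simp at h
  · rintro rfl; simp

/-- The indices of two commuting, distinct generators. -/
def Far (i j : Fin (n - 1)) : Prop := 1 < |((i : ℕ) : ℤ) - ((j : ℕ) : ℤ)|

/-- The indices of two adjacent generators. -/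
def Near (i j : Fin (n - 1)) : Prop := |((i : ℕ) : ℤ) - ((j : ℕ) : ℤ)| = 1

theorem Far.symm {i j : Fin (n - 1)} (h : Far i j) : Far j i := by
  unfold Far at *; rwa [abs_sub_comm]

theorem Near.symm {i j : Fin (n - 1)} (h : Near i j) : Near j i := by
  unfold Near at *; rwa [abs_sub_comm]

theorem eq_or_far_or_near (i j : Fin (n - 1)) : i = j ∨ Far i j ∨ Near i j := by
  simp only [Far, Near, Fin.ext_iff, abs_eq zero_le_one, lt_abs]
  omega

theorem not_far_self (i : Fin (n - 1)) : ¬ Far i i := by simp [Far]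

theorem not_near_self (i : Fin (n - 1)) : ¬ Near i i := by simp [Near]

theorem Far.not_near {i j : Fin (n - 1)} (h : Far i j) : ¬ Near i j := by
  simp only [Far, Near, abs_eq zero_le_one, lt_abs] at *
  omega

/-- The Coxeter graph of the braid monoid is a path: it has no triangle. -/
theorem Near.not_near_of_near {i j k : Fin (n - 1)} (h : Near i k) (h' : Near k j) :
    ¬ Near i j := by
  simp only [Near, abs_eq zero_le_one] at *
  omega

theorem Far.comm {i j : Fin (n - 1)} (h : Far i j) :
    (sigma i * sigma j : PosBraid n) = sigma j * sigma i := by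
  have := PresentedMonoid.mk_eq_mk_of_rel (ArtinRel.far i j h)
  simpa [map_mul, mk_of] using this.symm

theorem Near.braid {i j : Fin (n - 1)} (h : Near i j) :
    (sigma i * (sigma j * sigma i) : PosBraid n) = sigma j * (sigma i * sigma j) := by
  have := PresentedMonoid.mk_eq_mk_of_rel (ArtinRel.near i j h)
  simpa [map_mul, mk_of, mul_assoc] using this

theorem Far.comm_mul {i j : Fin (n - 1)} (h : Far i j) (x : PosBraid n) :
    sigma i * (sigma j * x) = sigma j * (sigma i * x) := by
  rw [← mul_assoc, h.comm, mul_assoc]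

theorem Near.braid_mul {i j : Fin (n - 1)} (h : Near i j) (x : PosBraid n) :
    sigma i * (sigma j * (sigma i * x)) = sigma j * (sigma i * (sigma j * x)) := by
  have := congrArg (· * x) h.braid
  simpa [mul_assoc] using this

/-- The complement of `σ_i` in the least common right multiple of `σ_i` and `σ_j`. -/
noncomputable def comp (i j : Fin (n - 1)) : PosBraid n :=
  open Classical in
  if i = j then 1 else if Near i j then sigma j * sigma i else sigma j

@[simp] theorem comp_self (i : Fin (n - 1)) : comp i i = 1 := by simp [comp]

theorem Near.comp_eq {i j : Fin (n - 1)} (h : Near i j) : comp i j = sigma j * sigma i := by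
  have : i ≠ j := by rintro rfl; exact not_near_self i h
  simp [comp, h, this]

theorem Far.comp_eq {i j : Fin (n - 1)} (h : Far i j) : comp i j = sigma j := by
  have : i ≠ j := by rintro rfl; exact not_far_self i h
  simp [comp, h.not_near, this]

theorem sigma_mul_comp (i j : Fin (n - 1)) : sigma i * comp i j = sigma j * comp j i := by
  rcases eq_or_far_or_near i j with rfl | h | h
  · rfl
  · rw [h.comp_eq, h.symm.comp_eq, h.comm]
  · rw [h.comp_eq, h.symm.comp_eq, h.braid]

/-- `SigmaSplit i a j b` says that the common multiple `σ_i a = σ_j b` is a multiple of the least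
common multiple of `σ_i` and `σ_j` given by the defining relation. -/
def SigmaSplit (i : Fin (n - 1)) (a : PosBraid n) (j : Fin (n - 1)) (b : PosBraid n) : Prop :=
  ∃ c, a = comp i j * c ∧ b = comp j i * c

theorem SigmaSplit.symm {i j : Fin (n - 1)} {a b : PosBraid n} (h : SigmaSplit i a j b) :
    SigmaSplit j b i a := by
  obtain ⟨c, h1, h2⟩ := h; exact ⟨c, h2, h1⟩

theorem SigmaSplit.eq {i : Fin (n - 1)} {a b : PosBraid n} (h : SigmaSplit i a i b) : a = b := by
  obtain ⟨c, h1, h2⟩ := h; rw [h1, h2]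

theorem SigmaSplit.far {i j : Fin (n - 1)} {a b : PosBraid n} (h : SigmaSplit i a j b)
    (hij : Far i j) : ∃ c, a = sigma j * c ∧ b = sigma i * c := by
  simpa only [SigmaSplit, hij.comp_eq, hij.symm.comp_eq] using h

theorem SigmaSplit.near {i j : Fin (n - 1)} {a b : PosBraid n} (h : SigmaSplit i a j b)
    (hij : Near i j) :
    ∃ c, a = sigma j * (sigma i * c) ∧ b = sigma i * (sigma j * c) := by
  simpa only [SigmaSplit, hij.comp_eq, hij.symm.comp_eq, mul_assoc] using h

theorem SigmaSplit.of_far {i j : Fin (n - 1)} {a b : PosBraid n} (c : PosBraid n) (hij : Far i j)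
    (ha : a = sigma j * c) (hb : b = sigma i * c) : SigmaSplit i a j b :=
  ⟨c, by rw [hij.comp_eq, ha], by rw [hij.symm.comp_eq, hb]⟩

theorem SigmaSplit.of_near {i j : Fin (n - 1)} {a b : PosBraid n} (c : PosBraid n)
    (hij : Near i j) (ha : a = sigma j * (sigma i * c)) (hb : b = sigma i * (sigma j * c)) :
    SigmaSplit i a j b :=
  ⟨c, by rw [hij.comp_eq, ha, mul_assoc], by rw [hij.symm.comp_eq, hb, mul_assoc]⟩

/-- Every equation `σ_i a = σ_j b` with `a` of length less than `L` splits. -/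
def SplitsBelow (n L : ℕ) : Prop :=
  ∀ (i j : Fin (n - 1)) (a b : PosBraid n), len a < L → sigma i * a = sigma j * b →
    SigmaSplit i a j b

/-- One case of the transitivity of `SigmaSplit`, with the three generators in a chain of relations
`σ_i`, `σ_k`, `σ_j`; cancelling the common letter of the two expressions for `c` leads to shorter
equations. -/
theorem SplitsBelow.trans_far_near {L : ℕ} (hL : SplitsBelow n L) {i j k : Fin (n - 1)}
    {a b c : PosBraid n} (hc : len c ≤ L) (hik : Far i k) (hkj : Near k j)
    (h1 : SigmaSplit i a k c) (h2 : SigmaSplit k c j b) : SigmaSplit i a j b := by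
  obtain ⟨p, rfl, rfl⟩ := h1.far hik
  obtain ⟨q, hq, rfl⟩ := h2.near hkj
  simp only [len_mul, len_sigma] at hc
  have hlen := congrArg len hq
  simp only [len_mul, len_sigma] at hlen
  have hpq := hL _ _ _ _ (by omega) hq
  rcases eq_or_far_or_near i j with rfl | hij | hij
  · exact absurd hkj.symm hik.not_near
  · obtain ⟨r, rfl, hr⟩ := hpq.far hij
    simp only [len_mul, len_sigma] at hc hlen
    obtain ⟨t, rfl, rfl⟩ := (hL _ _ _ _ (by omega) hr).far hik.symm
    refine .of_far (sigma k * (sigma j * t)) hij (hkj.braid_mul t) ?_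
    rw [← hij.comm_mul, hik.comm_mul]
  · obtain ⟨r, rfl, hr⟩ := hpq.near hij
    simp only [len_mul, len_sigma] at hc hlen
    obtain ⟨t, rfl, ht⟩ := (hL _ _ _ _ (by omega) hr).far hik.symm
    simp only [len_mul, len_sigma] at hlen
    obtain ⟨v, rfl, rfl⟩ := (hL _ _ _ _ (by omega) ht).near hkj.symm
    refine .of_near (sigma k * (sigma j * (sigma i * v))) hij ?_ ?_
    · rw [hik.comm_mul, hkj.braid_mul, ← hij.braid_mul, ← hik.comm_mul]
    · rw [← hij.braid_mul, hik.comm_mul, ← hik.comm_mul, hkj.braid_mul]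

theorem SplitsBelow.trans_near_near {L : ℕ} (hL : SplitsBelow n L) {i j k : Fin (n - 1)}
    {a b c : PosBraid n} (hc : len c ≤ L) (hik : Near i k) (hkj : Near k j)
    (h1 : SigmaSplit i a k c) (h2 : SigmaSplit k c j b) : SigmaSplit i a j b := by
  obtain ⟨p, rfl, rfl⟩ := h1.near hik
  obtain ⟨q, hq, rfl⟩ := h2.near hkj
  simp only [len_mul, len_sigma] at hc
  have hlen := congrArg len hq
  simp only [len_mul, len_sigma] at hlen
  have hpq := hL _ _ _ _ (by simp only [len_mul, len_sigma]; omega) hq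
  rcases eq_or_far_or_near i j with rfl | hij | hij
  · have := (hL _ _ _ _ (by omega) hpq.eq).eq
    subst this
    exact ⟨_, by rw [comp_self, one_mul], by rw [comp_self, one_mul]⟩
  · obtain ⟨r, hr, hr'⟩ := hpq.far hij
    obtain ⟨t, rfl, ht⟩ := (hL _ _ _ _ (by omega) hr).near hkj
    obtain ⟨t', rfl, ht'⟩ := (hL _ _ _ _ (by omega) hr').near hik.symm
    have hlen2 := congrArg len ht
    simp only [len_mul, len_sigma] at hc hlen hlen2
    have htt := hL _ _ _ _ (by simp only [len_mul, len_sigma]; omega) (ht.symm.trans ht')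
    have htt' := hL _ _ _ _ (by omega) htt.eq
    obtain ⟨v, rfl, rfl⟩ := htt'.far hij.symm
    refine .of_far (sigma k * (sigma j * (sigma i * (sigma k * v)))) hij ?_ ?_
    · rw [hij.comm_mul, hik.braid_mul, hkj.braid_mul]
    · rw [← hij.comm_mul, ← hkj.braid_mul, ← hik.braid_mul, hij.comm_mul]
  · exact absurd hij (hik.not_near_of_near hkj)

/-- The step of the induction on the length: if shorter equations split, then splitting is
transitive. -/
theorem SplitsBelow.trans {L : ℕ} (hL : SplitsBelow n L) {i j k : Fin (n - 1)}
    {a b c : PosBraid n} (ha : len a = len c) (hb : len b = len c) (hc : len c ≤ L)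
    (h1 : SigmaSplit i a k c) (h2 : SigmaSplit k c j b) : SigmaSplit i a j b := by
  rcases eq_or_far_or_near i k with rfl | hik | hik
  · rwa [h1.eq]
  · rcases eq_or_far_or_near k j with rfl | hkj | hkj
    · rwa [← h2.eq]
    · obtain ⟨p, rfl, rfl⟩ := h1.far hik
      obtain ⟨q, hq, rfl⟩ := h2.far hkj
      simp only [len_mul, len_sigma] at hb hc
      have hpq := hL _ _ _ _ (by omega) hq
      rcases eq_or_far_or_near i j with rfl | hij | hij
      · rw [hpq.eq]
        exact ⟨_, by rw [comp_self, one_mul], by rw [comp_self, one_mul]⟩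
      · obtain ⟨r, rfl, rfl⟩ := hpq.far hij
        exact .of_far (sigma k * r) hij (hkj.comm_mul r) (hik.comm_mul r).symm
      · obtain ⟨r, rfl, rfl⟩ := hpq.near hij
        refine .of_near (sigma k * r) hij ?_ ?_
        · rw [hkj.comm_mul, hik.comm_mul]
        · rw [← hik.comm_mul, hkj.comm_mul]
    · exact hL.trans_far_near hc hik hkj h1 h2
  · rcases eq_or_far_or_near k j with rfl | hkj | hkj
    · rwa [← h2.eq]
    · exact (hL.trans_far_near hc hkj.symm hik.symm h2.symm h1.symm).symm
    · exact hL.trans_near_near hc hik hkj h1 h2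

theorem len_mk (w : FreeMonoid (Fin (n - 1))) :
    len (PresentedMonoid.mk (ArtinRel n) w) = w.length := by
  induction w using FreeMonoid.inductionOn' with
  | one => rfl
  | of_mul i v ih => rw [map_mul, len_mul, ih, mk_of, len_sigma, FreeMonoid.length_mul]; rfl

theorem conGen_length {v w : FreeMonoid (Fin (n - 1))}
    (h : ConGen.Rel (ArtinRel n) v w) : v.length = w.length := by
  rw [← len_mk, ← len_mk, PresentedMonoid.mk_eq_mk_iff.2 h]

/-- The inner induction, on the derivation of an equality of words from Artin's relations. -/
theorem SplitsBelow.conGen {L : ℕ} (hL : SplitsBelow n L) {v w : FreeMonoid (Fin (n - 1))}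
    (h : ConGen.Rel (ArtinRel n) v w) (hlen : v.length ≤ L + 1) (i j : Fin (n - 1))
    (a b : FreeMonoid (Fin (n - 1))) (hv : v = FreeMonoid.of i * a)
    (hw : w = FreeMonoid.of j * b) :
    SigmaSplit i (PresentedMonoid.mk _ a) j (PresentedMonoid.mk _ b) := by
  induction h generalizing i j a b with
  | of v w h =>
    cases h with
    | far k l h =>
      obtain ⟨rfl, rfl⟩ : l = i ∧ FreeMonoid.of k = a := by
        exact (List.cons_eq_cons.1 hv)
      obtain ⟨rfl, rfl⟩ : k = j ∧ FreeMonoid.of l = b := by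
        exact (List.cons_eq_cons.1 hw)
      exact .of_far 1 (Far.symm h) (by simp [mk_of]) (by simp [mk_of])
    | near k l h =>
      obtain ⟨rfl, rfl⟩ : k = i ∧ FreeMonoid.of l * FreeMonoid.of k = a := by
        exact (List.cons_eq_cons.1 hv)
      obtain ⟨rfl, rfl⟩ : l = j ∧ FreeMonoid.of k * FreeMonoid.of l = b := by
        exact (List.cons_eq_cons.1 hw)
      exact .of_near 1 h (by simp [mk_of]) (by simp [mk_of])
  | refl v =>
    obtain ⟨rfl, rfl⟩ : i = j ∧ a = b := List.cons_eq_cons.1 (hv.symm.trans hw)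
    exact ⟨_, by rw [comp_self, one_mul], by rw [comp_self, one_mul]⟩
  | symm h ih => exact (ih (by rwa [conGen_length h]) _ _ _ _ hw hv).symm
  | @trans x y z h h' ih ih' =>
    have e := conGen_length h
    have e' := conGen_length h'
    subst hv hw
    rw [FreeMonoid.length_mul, FreeMonoid.length_of] at e e' hlen
    induction y using FreeMonoid.casesOn with
    | one => simp at e
    | of_mul k c =>
      rw [FreeMonoid.length_mul, FreeMonoid.length_of] at e e'
      have h1 := ih (by simpa using hlen) i k a c rfl rfl
      have h2 := ih' (by simp; omega) k j c b rfl rfl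
      refine hL.trans ?_ ?_ ?_ h1 h2 <;> simp only [len_mk] <;> omega
  | @mul w x y z h h' ih ih' =>
    have e := conGen_length h
    induction w using FreeMonoid.casesOn with
    | one =>
      obtain rfl : x = 1 := FreeMonoid.length_eq_zero.1 (by simpa using e.symm)
      exact ih' (by simpa using hlen) i j a b (by simpa using hv) (by simpa using hw)
    | of_mul k c =>
      induction x using FreeMonoid.casesOn with
      | one => simp at e
      | of_mul l d =>
        obtain ⟨rfl, rfl⟩ : k = i ∧ c * y = a := List.cons_eq_cons.1 hv
        obtain ⟨rfl, rfl⟩ : l = j ∧ d * z = b := List.cons_eq_cons.1 hw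
        simp only [FreeMonoid.length_mul] at hlen
        obtain ⟨p, hp, hp'⟩ := ih (by simp only [FreeMonoid.length_mul]; omega) k l c d rfl rfl
        have e' : PresentedMonoid.mk (ArtinRel n) y = PresentedMonoid.mk (ArtinRel n) z :=
          PresentedMonoid.mk_eq_mk_iff.2 h'
        exact ⟨p * PresentedMonoid.mk _ y, by rw [map_mul, hp, mul_assoc],
          by rw [map_mul, hp', mul_assoc, e']⟩

theorem splitsBelow (n L : ℕ) : SplitsBelow n L := by
  induction L with
  | zero => intro i j a b h; omega
  | succ L ih =>
    intro i j a b h e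
    obtain ⟨v, rfl⟩ := PresentedMonoid.surjective_mk a
    obtain ⟨w, rfl⟩ := PresentedMonoid.surjective_mk b
    rw [← mk_of, ← mk_of, ← map_mul, ← map_mul, PresentedMonoid.mk_eq_mk_iff] at e
    rw [len_mk] at h
    refine ih.conGen e ?_ i j v w rfl rfl
    simp only [FreeMonoid.length_mul, FreeMonoid.length_of]
    omega

/-- Garside's cancellation theorem: the common multiples of two generators are the multiples of
the one that is given by their defining relation. -/
theorem sigmaSplit_of_eq {i j : Fin (n - 1)} {a b : PosBraid n}
    (h : sigma i * a = sigma j * b) : SigmaSplit i a j b :=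
  splitsBelow n _ i j a b (Nat.lt_succ_self _) h

theorem mul_left_cancel_pos {a b c : PosBraid n} (h : a * b = a * c) : b = c := by
  induction a using sigma_mul_induction with
  | one => simpa using h
  | mul i x ih => exact ih (sigmaSplit_of_eq (by simpa only [mul_assoc] using h)).eq

/-! ### Greatest common left subwords -/

theorem LeftSubword.refl (x : PosBraid n) : LeftSubword x x := ⟨1, mul_one x⟩

theorem LeftSubword.trans {x y z : PosBraid n} (h : LeftSubword x y) (h' : LeftSubword y z) :
    LeftSubword x z := by
  obtain ⟨a, rfl⟩ := h
  obtain ⟨b, rfl⟩ := h'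
  exact ⟨a * b, by rw [mul_assoc]⟩

theorem leftSubword_mul_right (x y : PosBraid n) : LeftSubword x (x * y) := ⟨y, rfl⟩

theorem LeftSubword.len_le {x y : PosBraid n} (h : LeftSubword x y) : len x ≤ len y := by
  obtain ⟨a, rfl⟩ := h; simp

/-- If `x σ_i` and `x σ_j` are left subwords of `a`, so is the product of `x` and the least common
multiple of `σ_i` and `σ_j`. -/
theorem LeftSubword.mul_lcm {x a : PosBraid n} {i j : Fin (n - 1)}
    (hi : LeftSubword (x * sigma i) a) (hj : LeftSubword (x * sigma j) a) :
    LeftSubword (x * sigma i * comp i j) a := by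
  obtain ⟨p, rfl⟩ := hi
  obtain ⟨q, hq⟩ := hj
  rw [mul_assoc, mul_assoc] at hq
  obtain ⟨c, rfl, -⟩ := sigmaSplit_of_eq (mul_left_cancel_pos hq).symm
  exact ⟨c, by simp only [mul_assoc]⟩

/-- A common left subword of maximal length is a multiple of every other one. The induction shows,
by decreasing length of `x`, that `x ≺ g` and `x ≺ y` force `y ≺ g`; if `x σ_i ≺ g` and
`x σ_j ≺ y`, then both `x σ_i` and `x σ_j` are left subwords of the common left subword
`x (σ_i ∨ σ_j)`. -/
theorem exists_isMeet (a b : PosBraid n) : ∃ m, IsMeet a b m := by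
  obtain ⟨g, ⟨hga, hgb⟩, hmax⟩ : ∃ g, (LeftSubword g a ∧ LeftSubword g b) ∧
      ∀ y, LeftSubword y a → LeftSubword y b → len y ≤ len g := by
    -- maximal length is expressed as minimal codimension in `a`, to use `Nat.find`
    have hne : ∃ k, ∃ g, (LeftSubword g a ∧ LeftSubword g b) ∧ len a - len g = k :=
      ⟨_, 1, ⟨⟨a, one_mul a⟩, ⟨b, one_mul b⟩⟩, rfl⟩
    classical
    obtain ⟨g, hg, hk⟩ := Nat.find_spec hne
    refine ⟨g, hg, fun y hya hyb => ?_⟩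
    have := Nat.find_min' hne ⟨y, ⟨hya, hyb⟩, rfl⟩
    have := hya.len_le
    have := hg.1.len_le
    omega
  have key : ∀ m x y, len g - len x ≤ m → LeftSubword x g → LeftSubword x y →
      LeftSubword y a → LeftSubword y b → LeftSubword y g := by
    intro m
    induction m with
    | zero =>
      intro x y hm hxg hxy hya hyb
      obtain ⟨p, rfl⟩ := hxg
      obtain ⟨q, rfl⟩ := hxy
      have h1 := hmax _ hya hyb
      simp only [len_mul] at h1 hm
      rw [len_eq_zero.1 (show len q = 0 by omega), mul_one]
      exact leftSubword_mul_right x p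
    | succ m ih =>
      intro x y hm hxg hxy hya hyb
      obtain ⟨p, rfl⟩ := hxg
      obtain ⟨q, rfl⟩ := hxy
      rcases eq_one_or_eq_sigma_mul q with rfl | ⟨j, q, rfl⟩
      · rw [mul_one]; exact leftSubword_mul_right x p
      rcases eq_one_or_eq_sigma_mul p with rfl | ⟨i, p, rfl⟩
      · have h1 := hmax _ hya hyb
        simp only [len_mul, len_sigma, len_one] at h1
        omega
      rw [← mul_assoc] at hga hgb hya hyb ih ⊢
      rw [← mul_assoc]
      have hia := (leftSubword_mul_right _ p).trans hga
      have hib := (leftSubword_mul_right _ p).trans hgb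
      have hja := (leftSubword_mul_right _ q).trans hya
      have hjb := (leftSubword_mul_right _ q).trans hyb
      rw [← mul_assoc] at hmax hm
      simp only [len_mul, len_sigma] at hm
      have hL := ih (x * sigma i) (x * sigma i * comp i j) (by simp; omega)
        (leftSubword_mul_right _ _) (leftSubword_mul_right _ _)
        (hia.mul_lcm hja) (hib.mul_lcm hjb)
      have hjg : LeftSubword (x * sigma j) (x * sigma i * p) := by
        refine LeftSubword.trans ?_ hL
        rw [mul_assoc x, sigma_mul_comp, ← mul_assoc]
        exact leftSubword_mul_right _ _
      exact ih (x * sigma j) _ (by simp; omega) hjg (leftSubword_mul_right _ _) hya hyb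
  exact ⟨g, hga, hgb, fun z hza hzb => key _ 1 z le_rfl ⟨g, one_mul g⟩ ⟨z, one_mul z⟩ hza hzb⟩

/-! ### The fundamental braid -/

/-- The generator `σ_k` for an arbitrary index `k`, with value `1` outside the range. -/
def gen (n k : ℕ) : PosBraid n := if h : k < n - 1 then sigma ⟨k, h⟩ else 1

theorem gen_coe (i : Fin (n - 1)) : gen n i = sigma i := by simp [gen]

theorem gen_comm {i j : ℕ} (h : i + 1 < j) : gen n i * gen n j = gen n j * gen n i := by
  unfold gen
  split_ifs with hi hj
  · refine Far.comm ?_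
    simp only [Far, lt_abs]
    omega
  all_goals simp

theorem gen_braid {i : ℕ} (h : i + 1 < n - 1) :
    gen n i * gen n (i + 1) * gen n i = gen n (i + 1) * gen n i * gen n (i + 1) := by
  have hi : i < n - 1 := by omega
  simp only [gen, h, hi, dite_true, mul_assoc]
  refine Near.braid ?_
  simp [Near]

theorem sigmaRow_zero : sigmaRow n 0 = 1 := by simp [sigmaRow]

theorem sigmaRow_succ (k : ℕ) : sigmaRow n (k + 1) = sigmaRow n k * gen n k := by
  unfold sigmaRow gen
  split_ifs with h
  · rw [List.take_add_one, List.getElem?_eq_getElem (by simpa using h)]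
    simp
  · rw [List.take_of_length_le (by simp; omega), List.take_of_length_le (by simp; omega), mul_one]

/-- The product of the rows with less than `k` letters, in decreasing order. -/
def partialFundamental (n k : ℕ) : PosBraid n := ((List.range k).reverse.map (sigmaRow n)).prod

theorem partialFundamental_succ (k : ℕ) :
    partialFundamental n (k + 1) = sigmaRow n k * partialFundamental n k := by
  simp [partialFundamental, List.range_succ]

theorem gen_comm_sigmaRow {j k : ℕ} (h : k < j) :
    gen n j * sigmaRow n k = sigmaRow n k * gen n j := by
  induction k with
  | zero => simp [sigmaRow_zero]
  | succ k ih =>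
    rw [sigmaRow_succ, ← mul_assoc, ih (by omega), mul_assoc, ← gen_comm h, mul_assoc]

theorem gen_comm_partialFundamental {j k : ℕ} (h : k ≤ j) :
    gen n j * partialFundamental n k = partialFundamental n k * gen n j := by
  induction k with
  | zero => simp [partialFundamental]
  | succ k ih =>
    rw [partialFundamental_succ, ← mul_assoc, gen_comm_sigmaRow (by omega), mul_assoc,
      ih (by omega), mul_assoc]

/-- Moving a generator through a row shifts its index. -/
theorem sigmaRow_mul_gen {i k : ℕ} (h : i + 1 < k) (hk : k ≤ n - 1) :
    sigmaRow n k * gen n i = gen n (i + 1) * sigmaRow n k := by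
  induction k with
  | zero => omega
  | succ k ih =>
    rcases Nat.lt_or_ge (i + 1) k with h1 | h1
    · rw [sigmaRow_succ, mul_assoc, ← gen_comm h1, ← mul_assoc, ih h1 (by omega), mul_assoc]
    · obtain rfl : k = i + 1 := by omega
      rw [sigmaRow_succ, sigmaRow_succ, mul_assoc, mul_assoc, ← mul_assoc (gen n i),
        gen_braid (by omega), ← mul_assoc, ← mul_assoc, ← gen_comm_sigmaRow (Nat.lt_succ_self i)]
      simp only [mul_assoc]

/-- For `m = k - 1`, and together with `sigmaRow_succ`, both `σ_1 R_k R_{k-1}` and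
`R_k R_{k-1} σ_k` are `R_k R_k`, where `R_k = σ_1 ⋯ σ_k` (in one-based indexing). -/
theorem gen_zero_mul_sigmaRow_mul {k m : ℕ} (h : m < k) (hk : k ≤ n - 1) :
    gen n 0 * sigmaRow n k * sigmaRow n m = sigmaRow n (m + 1) * sigmaRow n k := by
  induction m with
  | zero => simp [sigmaRow_succ, sigmaRow_zero]
  | succ m ih =>
    rw [sigmaRow_succ m, ← mul_assoc, ih (by omega), mul_assoc, sigmaRow_mul_gen h hk,
      ← mul_assoc, ← sigmaRow_succ]

theorem partialFundamental_mul_gen {i k : ℕ} (h : i < k) (hk : k ≤ n - 1) :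
    partialFundamental n (k + 1) * gen n i =
      gen n (k - 1 - i) * partialFundamental n (k + 1) := by
  induction k with
  | zero => omega
  | succ k ih =>
    rw [partialFundamental_succ (k + 1)]
    rcases Nat.lt_or_ge i k with h1 | h1
    · rw [mul_assoc, ih h1 (by omega), ← mul_assoc, sigmaRow_mul_gen (by omega) hk, mul_assoc]
      congr 2
      omega
    · obtain rfl : i = k := by omega
      rw [partialFundamental_succ, mul_assoc, mul_assoc, ← gen_comm_partialFundamental le_rfl,
        ← mul_assoc (sigmaRow n i), ← sigmaRow_succ]
      simp only [add_tsub_cancel_right, Nat.sub_self]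
      rw [← mul_assoc (gen n 0), ← mul_assoc (gen n 0 * _),
        gen_zero_mul_sigmaRow_mul (Nat.lt_succ_self i) hk, mul_assoc]

theorem gen_leftSubword_partialFundamental {i k : ℕ} (h : i < k) (hk : k ≤ n - 1) :
    LeftSubword (gen n i) (partialFundamental n (k + 1)) := by
  induction k generalizing i with
  | zero => omega
  | succ k ih =>
    rw [partialFundamental_succ (k + 1)]
    cases i with
    | zero =>
      refine LeftSubword.trans ?_ (leftSubword_mul_right _ _)
      clear ih h hk
      induction k with
      | zero => simpa [sigmaRow_succ, sigmaRow_zero] using LeftSubword.refl _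
      | succ k ih => rw [sigmaRow_succ]; exact ih.trans (leftSubword_mul_right _ _)
    | succ i =>
      obtain ⟨q, hq⟩ := ih (i := i) (by omega) (by omega)
      rw [← hq, ← mul_assoc, sigmaRow_mul_gen h hk, mul_assoc]
      exact leftSubword_mul_right _ _

theorem fundamental_mul_sigma (i : Fin (n - 1)) :
    fundamental n * sigma i = sigma i.rev * fundamental n := by
  have hi := i.isLt
  obtain ⟨m, rfl⟩ : ∃ m, n = m + 1 := ⟨n - 1, by omega⟩
  have := partialFundamental_mul_gen (n := m + 1) (i := i) (k := m) (by omega) (by omega)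
  rw [gen_coe, show m - 1 - (i : ℕ) = (i.rev : ℕ) by rw [Fin.val_rev]; omega, gen_coe] at this
  exact this

theorem sigma_leftSubword_fundamental (i : Fin (n - 1)) :
    LeftSubword (sigma i) (fundamental n) := by
  have hi := i.isLt
  obtain ⟨m, rfl⟩ : ∃ m, n = m + 1 := ⟨n - 1, by omega⟩
  have := gen_leftSubword_partialFundamental (n := m + 1) (i := i) (k := m) (by omega) (by omega)
  rwa [gen_coe] at this

theorem flipHom_sigma (i : Fin (n - 1)) : flipHom n (sigma i) = sigma i.rev := rfl

theorem flipHom_flipHom (x : PosBraid n) : flipHom n (flipHom n x) = x :=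
  DFunLike.congr_fun (flipHom_comp_flipHom n) x

/-- Moving a positive braid through `Δ` flips it. -/
theorem fundamental_mul (x : PosBraid n) :
    fundamental n * x = flipHom n x * fundamental n := by
  induction x using sigma_mul_induction with
  | one => simp
  | mul i x ih =>
    rw [← mul_assoc, fundamental_mul_sigma, mul_assoc, ih, map_mul, flipHom_sigma, mul_assoc]

theorem mul_fundamental (x : PosBraid n) :
    x * fundamental n = fundamental n * flipHom n x := by
  rw [fundamental_mul, flipHom_flipHom]

theorem fundamental_sq_comm (x : PosBraid n) :
    x * (fundamental n * fundamental n) = fundamental n * fundamental n * x := by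
  rw [← mul_assoc, mul_fundamental x, mul_assoc, ← fundamental_mul, mul_assoc]

theorem fundamental_sq_pow_comm (x : PosBraid n) (r : ℕ) :
    x * (fundamental n * fundamental n) ^ r = (fundamental n * fundamental n) ^ r * x :=
  (show Commute x _ from fundamental_sq_comm x).pow_right r

/-! ### The positive monoid embeds in the group -/

theorem exists_mul_eq_fundamental_sq_pow (x : PosBraid n) :
    ∃ r y, x * y = (fundamental n * fundamental n) ^ r := by
  induction x using sigma_mul_induction with
  | one => exact ⟨0, 1, by simp⟩
  | mul i x ih =>
    obtain ⟨r, y, hy⟩ := ih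
    obtain ⟨z, hz⟩ := sigma_leftSubword_fundamental i
    refine ⟨r + 1, y * (z * fundamental n), ?_⟩
    calc sigma i * x * (y * (z * fundamental n))
        = sigma i * (x * y) * (z * fundamental n) := by simp only [mul_assoc]
      _ = (fundamental n * fundamental n) ^ r * (sigma i * z * fundamental n) := by
          rw [hy, fundamental_sq_pow_comm]; simp only [mul_assoc]
      _ = _ := by rw [hz, pow_succ]

/-- Right cancellation follows from left cancellation, since every element has a right multiple
that is central. -/
theorem mul_right_cancel_pos {a b c : PosBraid n} (h : a * c = b * c) : a = b := by
  obtain ⟨r, y, hy⟩ := exists_mul_eq_fundamental_sq_pow c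
  have h2 := congrArg (· * y) h
  simp only [mul_assoc, hy, fundamental_sq_pow_comm] at h2
  exact mul_left_cancel_pos h2

theorem exists_common_left_multiple (a b : PosBraid n) : ∃ p q, p * a = q * b := by
  obtain ⟨r, y, hy⟩ := exists_mul_eq_fundamental_sq_pow b
  have hyb : y * b = (fundamental n * fundamental n) ^ r := by
    apply mul_left_cancel_pos (a := b)
    rw [← mul_assoc, hy, fundamental_sq_pow_comm]
  exact ⟨(fundamental n * fundamental n) ^ r, a * y, by
    rw [mul_assoc a, hyb, fundamental_sq_pow_comm]⟩

/-- The positive monoid is cancellative with common multiples, so it has a group of fractions. -/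
noncomputable instance oreSetTop (n : ℕ) :
    OreLocalization.OreSet (⊤ : Submonoid (PosBraid n)) where
  ore_right_cancel _ _ _ h := ⟨1, by rw [mul_right_cancel_pos h]⟩
  oreNum a s := (exists_common_left_multiple a s).choose_spec.choose
  oreDenom a s := ⟨(exists_common_left_multiple a s).choose, trivial⟩
  ore_eq a s := (exists_common_left_multiple a s).choose_spec.choose_spec

/-- The braid group maps to the group of fractions of the positive monoid. -/
noncomputable def toFractions (n : ℕ) :
    Braid n →* (OreLocalization (⊤ : Submonoid (PosBraid n)) (PosBraid n))ˣ :=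
  PresentedGroup.toGroup
    (f := fun i => OreLocalization.numeratorUnit
      (⟨sigma i, trivial⟩ : (⊤ : Submonoid (PosBraid n)))) (by
    have key : ∀ v : FreeMonoid (Fin (n - 1)),
        ((FreeGroup.lift (fun i => OreLocalization.numeratorUnit
            (⟨sigma i, trivial⟩ : (⊤ : Submonoid (PosBraid n))))
          (FreeMonoid.lift FreeGroup.of v) : (OreLocalization _ _)ˣ) :
          OreLocalization (⊤ : Submonoid (PosBraid n)) (PosBraid n)) =
          OreLocalization.numeratorHom (PresentedMonoid.mk (ArtinRel n) v) := by
      intro v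
      induction v using FreeMonoid.inductionOn' with
      | one => simp only [map_one, Units.val_one]
      | of_mul i v ih => simp only [map_mul, Units.val_mul, ih]; congr 1; simp; rfl
    rintro r ⟨v, w, h, rfl⟩
    rw [map_mul, map_inv, mul_inv_eq_one, Units.ext_iff, key, key,
      PresentedMonoid.mk_eq_mk_of_rel h])

theorem toBraid_sigma (i : Fin (n - 1)) : toBraid n (sigma i) = PresentedGroup.of i := rfl

theorem toFractions_toBraid (x : PosBraid n) :
    (toFractions n (toBraid n x) : OreLocalization (⊤ : Submonoid (PosBraid n)) (PosBraid n)) =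
      OreLocalization.numeratorHom x := by
  induction x using sigma_mul_induction with
  | one => simp only [map_one, Units.val_one]
  | mul i x ih =>
    rw [map_mul, map_mul, Units.val_mul, ih, map_mul, toBraid_sigma, toFractions,
      PresentedGroup.toGroup.of]
    rfl

theorem toBraid_injective (n : ℕ) : Function.Injective (toBraid n) := by
  intro x y h
  have h2 : (OreLocalization.numeratorHom x :
      OreLocalization (⊤ : Submonoid (PosBraid n)) (PosBraid n)) =
      OreLocalization.numeratorHom y := by
    rw [← toFractions_toBraid, ← toFractions_toBraid, h]
  rw [OreLocalization.numeratorHom_apply, OreLocalization.numeratorHom_apply,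
    OreLocalization.oreDiv_eq_iff] at h2
  obtain ⟨u, v, huv, huv'⟩ := h2
  simp only [Submonoid.smul_def, smul_eq_mul, OneMemClass.coe_one, mul_one] at huv huv'
  rw [huv'] at huv
  exact (mul_left_cancel_pos huv).symm

end BraidTheory

/-! ### Garside groups -/

/-- A Garside structure on a group, given by its positive elements and its Garside element `Δ`: the
order `a ≤ b` defined by `a⁻¹ b` being positive has meets, every element lies between two powers of
`Δ`, and a homomorphism to `ℤ`, the weight, is positive on positive elements other than `1` and has
finite sublevel sets there. The square of the Garside element is assumed to be central. Meets are
required for positive elements only, since multiplication by powers of `Δ` gives the others. -/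
class GarsideStructure (G : Type*) [Group G] where
  pos : Submonoid G
  delta : G
  weight : G →* Multiplicative ℤ
  weight_pos : ∀ a ∈ pos, a ≠ 1 → 0 < (weight a).toAdd
  finite_weight_le : ∀ m : ℤ, {a | a ∈ pos ∧ (weight a).toAdd ≤ m}.Finite
  delta_mem : delta ∈ pos
  delta_ne_one : delta ≠ 1
  conj_delta_mem : ∀ a ∈ pos, delta * a * delta⁻¹ ∈ pos
  delta_sq_comm : ∀ g, Commute (delta ^ 2) g
  exists_mul_mem : ∀ g, ∃ r : ℕ, g * delta ^ r ∈ pos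
  exists_meet : ∀ a ∈ pos, ∀ b ∈ pos, ∃ m, m⁻¹ * a ∈ pos ∧ m⁻¹ * b ∈ pos ∧
    ∀ z ∈ pos, z⁻¹ * a ∈ pos → z⁻¹ * b ∈ pos → z⁻¹ * m ∈ pos
  exists_simple : ∀ a ∈ pos, a ≠ 1 → ∃ b ∈ pos, b ≠ 1 ∧ b⁻¹ * a ∈ pos ∧ b⁻¹ * delta ∈ pos

namespace Garside

open GarsideStructure

variable {G : Type*} [Group G] [GarsideStructure G]

local notation "Δ" => (GarsideStructure.delta : G)

/-- The weight of an element of a Garside group, as an integer. -/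
def wt (g : G) : ℤ := (weight g).toAdd

@[simp] theorem wt_one : wt (1 : G) = 0 := by simp [wt]
@[simp] theorem wt_mul (g h : G) : wt (g * h) = wt g + wt h := by simp [wt]
@[simp] theorem wt_zpow (g : G) (m : ℤ) : wt (g ^ m) = m * wt g := by simp [wt]

/-- The left-invariant order of a Garside group: `a ≤ b` if `a⁻¹ b` is positive. The priority is low
because the instance applies to every type. -/
instance (priority := 50) : PartialOrder G where
  le a b := a⁻¹ * b ∈ (pos : Submonoid G)
  le_refl a := by simp [one_mem]
  le_trans a b c h h' := by
    have := mul_mem h h'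
    simpa [mul_assoc] using this
  le_antisymm a b h h' := by
    by_contra hne
    have h1 := weight_pos _ h (by rwa [ne_eq, inv_mul_eq_one])
    have h2 := weight_pos _ h' (by rw [ne_eq, inv_mul_eq_one]; exact fun e => hne e.symm)
    simp only [map_mul, map_inv, toAdd_mul, toAdd_inv] at h1 h2
    omega

theorem le_def {a b : G} : a ≤ b ↔ a⁻¹ * b ∈ (pos : Submonoid G) := Iff.rfl

theorem one_le_iff {a : G} : 1 ≤ a ↔ a ∈ (pos : Submonoid G) := by simp [le_def]

instance (priority := 50) : MulLeftMono G where
  elim a b c h := by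
    change b⁻¹ * c ∈ (pos : Submonoid G) at h
    change (a * b)⁻¹ * (a * c) ∈ (pos : Submonoid G)
    simpa [mul_assoc] using h

theorem wt_le_wt {a b : G} (h : a ≤ b) : wt a ≤ wt b := by
  rcases eq_or_ne a b with rfl | hne
  · rfl
  have h1 := weight_pos _ h (by rwa [ne_eq, inv_mul_eq_one])
  simp only [map_mul, map_inv, toAdd_mul, toAdd_inv] at h1
  simp only [wt]
  omega

theorem eq_of_le_of_wt_le {a b : G} (h : a ≤ b) (hw : wt b ≤ wt a) : a = b := by
  by_contra hne
  have h1 := weight_pos _ h (by rwa [ne_eq, inv_mul_eq_one])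
  simp only [map_mul, map_inv, toAdd_mul, toAdd_inv] at h1
  simp only [wt] at hw
  omega

theorem one_le_delta : 1 ≤ Δ := one_le_iff.2 delta_mem

theorem wt_delta_pos : 0 < wt Δ := weight_pos _ delta_mem delta_ne_one

/-- Even powers of the Garside element are central. -/
theorem delta_zpow_comm {z : ℤ} (hz : Even z) (g : G) : Commute (Δ ^ z) g := by
  obtain ⟨w, rfl⟩ := even_iff_two_dvd.1 hz
  rw [zpow_mul]
  exact_mod_cast (delta_sq_comm g).zpow_left w

theorem one_le_conj (z : ℤ) {a : G} (ha : 1 ≤ a) : 1 ≤ Δ ^ z * a * Δ ^ (-z) := by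
  rcases Int.even_or_odd z with hz | hz
  · rw [(delta_zpow_comm hz a).eq, mul_assoc, ← zpow_add]
    simpa using ha
  · obtain ⟨w, hw⟩ := hz
    have h : Commute (Δ ^ (2 * w)) (Δ * a * Δ⁻¹) := delta_zpow_comm (by simp) _
    have h2 : Δ ^ z * a * Δ ^ (-z) = Δ * a * Δ⁻¹ := by
      calc Δ ^ z * a * Δ ^ (-z) = Δ ^ (2 * w) * (Δ * a * Δ⁻¹) * (Δ ^ (2 * w))⁻¹ := by
            rw [hw, zpow_add, neg_add, add_comm (-(2 * w)), zpow_add, zpow_neg]; group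
        _ = _ := by rw [h.eq]; group
    rw [h2]
    exact one_le_iff.2 (conj_delta_mem _ (one_le_iff.1 ha))

/-- The order is left invariant, and invariant under right multiplication by powers of `Δ`. -/
theorem mul_zpow_le {a b : G} (h : a ≤ b) (z : ℤ) : a * Δ ^ z ≤ b * Δ ^ z := by
  have h1 : (1 : G) ≤ a⁻¹ * b := by rwa [le_inv_mul_iff_mul_le, mul_one]
  have h2 := one_le_conj (-z) h1
  rw [neg_neg, mul_assoc, zpow_neg, le_inv_mul_iff_mul_le, mul_one, mul_assoc,
    le_inv_mul_iff_mul_le] at h2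
  exact h2

theorem mul_zpow_le_iff {a b : G} {z : ℤ} : a * Δ ^ z ≤ b ↔ a ≤ b * Δ ^ (-z) := by
  constructor <;> intro h
  · simpa [mul_assoc] using mul_zpow_le h (-z)
  · simpa [mul_assoc] using mul_zpow_le h z

theorem le_mul_zpow_iff {a b : G} {z : ℤ} : a ≤ b * Δ ^ z ↔ a * Δ ^ (-z) ≤ b := by
  rw [mul_zpow_le_iff, neg_neg]

theorem zpow_mul_le_iff {a b : G} {z : ℤ} : Δ ^ z * a ≤ b ↔ a ≤ Δ ^ (-z) * b := by
  rw [zpow_neg, le_inv_mul_iff_mul_le]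

theorem zpow_le_zpow {i j : ℤ} (h : i ≤ j) : Δ ^ i ≤ Δ ^ j := by
  obtain ⟨m, rfl⟩ := Int.le.dest h
  rw [zpow_add, zpow_natCast]
  exact le_mul_of_one_le_right' (one_le_pow_of_one_le' one_le_delta m)

theorem zpow_le_zpow_iff {i j : ℤ} : Δ ^ i ≤ Δ ^ j ↔ i ≤ j := by
  refine ⟨fun h => ?_, zpow_le_zpow⟩
  have := wt_le_wt h
  rw [wt_zpow, wt_zpow] at this
  exact le_of_mul_le_mul_right this wt_delta_pos

theorem zpow_le_mul_zpow {a : G} (h : 1 ≤ a) (z : ℤ) : Δ ^ z ≤ a * Δ ^ z := by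
  simpa using mul_zpow_le h z

theorem exists_pos_mul_even_zpow (a : G) : ∃ r : ℤ, Even r ∧ 0 ≤ r ∧ 1 ≤ a * Δ ^ r := by
  obtain ⟨r, hr⟩ := exists_mul_mem a
  rw [← one_le_iff] at hr
  refine ⟨r + r, ⟨r, rfl⟩, by positivity, hr.trans ?_⟩
  rw [zpow_add, zpow_natCast, ← mul_assoc]
  exact le_mul_of_one_le_right' (one_le_pow_of_one_le' one_le_delta r)

theorem exists_le_zpow (a : G) : ∃ r : ℤ, a ≤ Δ ^ r := by
  obtain ⟨r, hr⟩ := exists_mul_mem a⁻¹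
  rw [← one_le_iff, le_inv_mul_iff_mul_le, mul_one] at hr
  exact ⟨r, by simpa using hr⟩

theorem exists_zpow_le (a : G) : ∃ r : ℤ, Δ ^ r ≤ a := by
  obtain ⟨r, -, -, hr⟩ := exists_pos_mul_even_zpow a
  exact ⟨-r, by simpa [le_mul_zpow_iff] using hr⟩

theorem exists_isGLB (a b : G) : ∃ m : G, IsGLB {a, b} m := by
  obtain ⟨p, -, -, hp⟩ := exists_pos_mul_even_zpow a
  obtain ⟨q, -, -, hq⟩ := exists_pos_mul_even_zpow b
  have ha : 1 ≤ a * Δ ^ (max p q) := by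
    rw [le_mul_zpow_iff, one_mul]
    rw [le_mul_zpow_iff, one_mul] at hp
    exact (zpow_le_zpow (by simp)).trans hp
  have hb : 1 ≤ b * Δ ^ (max p q) := by
    rw [le_mul_zpow_iff, one_mul]
    rw [le_mul_zpow_iff, one_mul] at hq
    exact (zpow_le_zpow (by simp)).trans hq
  generalize max p q = r at ha hb
  obtain ⟨m, hma, hmb, hm⟩ := exists_meet _ (one_le_iff.1 ha) _ (one_le_iff.1 hb)
  rw [← le_def] at hma hmb
  refine ⟨m * Δ ^ (-r), ?_, ?_⟩
  · rintro x (rfl | rfl)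
    · rwa [← le_mul_zpow_iff]
    · rwa [← le_mul_zpow_iff]
  · intro z hz
    have hza : z ≤ a := hz (by simp)
    have hzb : z ≤ b := hz (by simp)
    -- `exists_meet` compares `m` with positive elements only, so `z` is shifted once more
    obtain ⟨s, -, hs, hzs⟩ := exists_pos_mul_even_zpow (z * Δ ^ r)
    obtain ⟨k, hka, hkb, hk⟩ := exists_meet (a * Δ ^ r * Δ ^ s)
      (one_le_iff.1 (ha.trans (by
        rw [le_mul_zpow_iff]
        simpa using mul_le_mul_right (zpow_le_zpow (i := -s) (j := 0) (by omega)) (a * Δ ^ r))))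
      (b * Δ ^ r * Δ ^ s)
      (one_le_iff.1 (hb.trans (by
        rw [le_mul_zpow_iff]
        simpa using mul_le_mul_right (zpow_le_zpow (i := -s) (j := 0) (by omega)) (b * Δ ^ r))))
    replace hm : ∀ z : G, 1 ≤ z → z ≤ a * Δ ^ r → z ≤ b * Δ ^ r → z ≤ m :=
      fun z hz => hm z (one_le_iff.1 hz)
    replace hk : ∀ z : G, 1 ≤ z → z ≤ a * Δ ^ r * Δ ^ s → z ≤ b * Δ ^ r * Δ ^ s → z ≤ k :=
      fun z hz => hk z (one_le_iff.1 hz)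
    have h1 : z * Δ ^ r * Δ ^ s ≤ k :=
      hk _ hzs (mul_zpow_le (mul_zpow_le hza _) _) (mul_zpow_le (mul_zpow_le hzb _) _)
    have h2 : k * Δ ^ (-s) ≤ m := by
      refine hm _ ?_ (le_mul_zpow_iff.1 hka) (le_mul_zpow_iff.1 hkb)
      rw [le_mul_zpow_iff, neg_neg, one_mul]
      exact hk _ (by simpa using zpow_le_zpow hs) (zpow_le_mul_zpow ha s) (zpow_le_mul_zpow hb s)
    rw [← mul_zpow_le_iff]
    exact (by simpa [mul_assoc] using mul_zpow_le h1 (-s) : z * Δ ^ r ≤ k * Δ ^ (-s)).trans h2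

noncomputable instance (priority := 50) : SemilatticeInf G where
  inf a b := (exists_isGLB a b).choose
  inf_le_left a b := (exists_isGLB a b).choose_spec.1 (by simp)
  inf_le_right a b := (exists_isGLB a b).choose_spec.1 (by simp)
  le_inf a b c h h' := (exists_isGLB b c).choose_spec.2 (by
    rintro x (rfl | rfl) <;> assumption)

theorem zpow_le_pow {g : G} {u : ℤ} (h : Δ ^ u ≤ g) (m : ℕ) : Δ ^ (m * u) ≤ g ^ m := by
  induction m with
  | zero => simp
  | succ m ih =>
    rw [pow_succ]
    refine le_trans ?_ (mul_le_mul_right h (g ^ m))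
    have := mul_zpow_le ih u
    rwa [← zpow_add, show (m : ℤ) * u + u = ((m + 1 : ℕ) : ℤ) * u by push_cast; ring] at this

theorem pow_le_zpow {g : G} {u : ℤ} (h : g ≤ Δ ^ u) (m : ℕ) : g ^ m ≤ Δ ^ (m * u) := by
  induction m with
  | zero => simp
  | succ m ih =>
    rw [pow_succ]
    refine (mul_le_mul_right h (g ^ m)).trans ?_
    have := mul_zpow_le ih u
    rwa [← zpow_add, show (m : ℤ) * u + u = ((m + 1 : ℕ) : ℤ) * u by push_cast; ring] at this

/-! ### Cycling and its iterates -/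

/-- The initial factor of `g`, moved to the front of `g Δ⁻ᵘ`. If `u` is the infimum of
`g = Δᵘ x₁ ⋯ x_k`, this is `Δᵘ x₁ Δ⁻ᵘ`. -/
noncomputable def init (u : ℤ) (g : G) : G := g * Δ ^ (-u) ⊓ Δ

/-- Cycling of `g` with respect to the exponent `u`, which need not be the infimum of `g`. -/
noncomputable def cyc (u : ℤ) (g : G) : G := (init u g)⁻¹ * g * init u g

/-- The product of the initial factors of `g` and of its first `j - 1` iterated cyclings. -/
noncomputable def orb (u : ℤ) (g : G) : ℕ → G
  | 0 => 1
  | j + 1 => orb u g j * init u ((cyc u)^[j] g)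

theorem cyc_iterate (u : ℤ) (g : G) (j : ℕ) :
    (cyc u)^[j] g = (orb u g j)⁻¹ * g * orb u g j := by
  induction j with
  | zero => simp [orb]
  | succ j ih =>
    rw [Function.iterate_succ_apply', orb, cyc, mul_inv_rev]
    nth_rw 2 [ih]
    simp only [mul_assoc]

theorem commute_orb {u : ℤ} {g : G} {j : ℕ} (h : (cyc u)^[j] g = g) : Commute (orb u g j) g := by
  rw [cyc_iterate, mul_assoc, inv_mul_eq_iff_eq_mul] at h
  exact h.symm

theorem orb_add (u : ℤ) (g : G) (i j : ℕ) :
    orb u g (i + j) = orb u g i * orb u ((cyc u)^[i] g) j := by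
  induction j with
  | zero => simp [orb]
  | succ j ih =>
    rw [← add_assoc, orb, ih, orb, mul_assoc, ← Function.iterate_add_apply, add_comm j i]

/-- The product of the first `j` initial factors is the meet of the elements `gⁱ` for `i ≤ j`, up
to powers of `Δ`. All properties of iterated cycling below follow from this. -/
theorem le_orb_iff {u : ℤ} {g c : G} {j : ℕ} :
    c ≤ orb u g j ↔ ∀ i : ℕ, i ≤ j → c ≤ g ^ i * Δ ^ (j - i * (u + 1) : ℤ) := by
  induction j generalizing c with
  | zero => simp [orb]
  | succ j ih =>
    have h1 : c ≤ orb u g (j + 1) ↔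
        g⁻¹ * c * Δ ^ u ≤ orb u g j ∧ c * Δ ^ (-1 : ℤ) ≤ orb u g j := by
      have e : (orb u g j)⁻¹ * g * orb u g j * Δ ^ (-u) =
          (orb u g j)⁻¹ * (g * (orb u g j * Δ ^ (-u))) := by simp only [mul_assoc]
      rw [orb, ← inv_mul_le_iff_le_mul, init, le_inf_iff, cyc_iterate, e, mul_le_mul_iff_left,
        ← inv_mul_le_iff_le_mul (b := g), le_mul_zpow_iff, neg_neg, inv_mul_le_iff_le_mul,
        mul_zpow_le_iff (z := -1), neg_neg, zpow_one]
    rw [h1, ih, ih]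
    have e1 : ∀ i : ℕ, g⁻¹ * c * Δ ^ u ≤ g ^ i * Δ ^ (j - i * (u + 1) : ℤ) ↔
        c ≤ g ^ (i + 1) * Δ ^ ((j + 1 : ℕ) - (i + 1 : ℕ) * (u + 1) : ℤ) := by
      intro i
      rw [mul_zpow_le_iff, inv_mul_le_iff_le_mul, pow_succ', mul_assoc, mul_assoc, ← zpow_add]
      push_cast
      ring_nf
    have e2 : ∀ i : ℕ, c * Δ ^ (-1 : ℤ) ≤ g ^ i * Δ ^ (j - i * (u + 1) : ℤ) ↔
        c ≤ g ^ i * Δ ^ ((j + 1 : ℕ) - i * (u + 1) : ℤ) := by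
      intro i
      rw [mul_zpow_le_iff, mul_assoc, ← zpow_add]
      push_cast
      ring_nf
    simp only [e1, e2]
    constructor
    · rintro ⟨h, h'⟩ i hi
      rcases Nat.lt_or_ge j i with hij | hij
      · obtain rfl : i = j + 1 := by omega
        exact h j le_rfl
      · exact h' i hij
    · intro h
      exact ⟨fun i hi => h (i + 1) (by omega), fun i hi => h i (by omega)⟩

theorem orb_one (u : ℤ) (g : G) : orb u g 1 = init u g := by simp [orb]

theorem orb_le_pow_mul {u : ℤ} {g : G} {i j : ℕ} (h : i ≤ j) :
    orb u g j ≤ g ^ i * Δ ^ (j - i * (u + 1) : ℤ) := le_orb_iff.1 le_rfl i h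

theorem orb_le_delta_pow (u : ℤ) (g : G) (j : ℕ) : orb u g j ≤ Δ ^ (j : ℤ) := by
  simpa using orb_le_pow_mul (u := u) (g := g) (Nat.zero_le j)

theorem zpow_le_cyc {u : ℤ} {g : G} (h : Δ ^ u ≤ g) : Δ ^ u ≤ cyc u g := by
  have h1 : 1 ≤ init u g := le_inf (by rw [le_mul_zpow_iff]; simpa using h) one_le_delta
  rw [cyc, mul_assoc, le_inv_mul_iff_mul_le, mul_zpow_le_iff, init]
  refine inf_le_left.trans (mul_zpow_le ?_ _)
  exact le_mul_of_one_le_right' h1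

theorem orb_conj (u : ℤ) (g : G) (z : ℤ) (j : ℕ) :
    orb u (Δ ^ z * g * Δ ^ (-z)) j = Δ ^ z * orb u g j * Δ ^ (-z) := by
  refine eq_of_forall_le_iff fun c => ?_
  rw [le_mul_zpow_iff, neg_neg, ← neg_neg z, ← zpow_mul_le_iff, neg_neg, le_orb_iff, le_orb_iff]
  refine forall₂_congr fun i _ => ?_
  have : (Δ ^ z * g * Δ ^ (-z)) ^ i = Δ ^ z * g ^ i * Δ ^ (-z) := by
    rw [zpow_neg, conj_pow]
  rw [this, zpow_mul_le_iff, neg_neg, mul_zpow_le_iff]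
  simp only [mul_assoc, ← zpow_add]
  ring_nf

theorem cyc_conj (u : ℤ) (g : G) (z : ℤ) :
    cyc u (Δ ^ z * g * Δ ^ (-z)) = Δ ^ z * cyc u g * Δ ^ (-z) := by
  simp only [cyc, ← orb_one, orb_conj]
  group

/-- Transport along iterated cycling: a positive element conjugating `g` to `h` is carried to an
element conjugating the iterated cyclings, which is again positive and not larger in terms of
powers of `Δ`. -/
theorem orb_transport {u : ℤ} {g h s : G} (hs : 1 ≤ s) {r : ℤ} (hr : s ≤ Δ ^ r)
    (e : g * s = s * h) (j : ℕ) :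
    1 ≤ (orb u g j)⁻¹ * s * orb u h j ∧ (orb u g j)⁻¹ * s * orb u h j ≤ Δ ^ r := by
  have epow : ∀ i : ℕ, s * h ^ i = g ^ i * s := fun i =>
    (show SemiconjBy s h g from e.symm).pow_right i
  constructor
  · rw [mul_assoc, le_inv_mul_iff_mul_le, mul_one, ← inv_mul_le_iff_le_mul, le_orb_iff]
    intro i hi
    rw [inv_mul_le_iff_le_mul, ← mul_assoc, epow, mul_assoc]
    exact (orb_le_pow_mul hi).trans (mul_le_mul_right (zpow_le_mul_zpow hs _) _)
  · rw [mul_assoc, inv_mul_le_iff_le_mul, le_mul_zpow_iff, le_orb_iff]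
    intro i hi
    rw [mul_zpow_le_iff, neg_neg]
    refine (mul_le_mul_right (orb_le_pow_mul hi) s).trans ?_
    rw [← mul_assoc, epow, mul_assoc, mul_assoc]
    refine mul_le_mul_right ?_ _
    rw [← zpow_add, add_comm _ r, zpow_add]
    exact mul_zpow_le hr _

theorem finite_Icc_one (a : G) : {s : G | 1 ≤ s ∧ s ≤ a}.Finite :=
  (finite_weight_le (wt a)).subset fun _ hs => ⟨one_le_iff.1 hs.1, wt_le_wt hs.2⟩

theorem iterate_mul_eq_self {α : Type*} {f : α → α} {x : α} {m : ℕ} (h : f^[m] x = x) (i : ℕ) :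
    f^[m * i] x = x := by
  rw [Function.iterate_mul]; exact Function.iterate_fixed h i

/-- If `g` and `h` are conjugate and both are fixed by some iterate of cycling, then transport
along a suitable number of cyclings fixes some element that conjugates `g` to `h`. -/
theorem exists_periodic_transport {u : ℤ} {g h s : G} (e : g * s = s * h) {m : ℕ}
    (hg : (cyc u)^[m] g = g) (hh : (cyc u)^[m] h = h) :
    ∃ i, 0 < i ∧ ∃ t, g * t = t * h ∧ orb u g (m * i) * t = t * orb u h (m * i) := by
  obtain ⟨q, hq, -, hs⟩ := exists_pos_mul_even_zpow s
  have e' : g * (s * Δ ^ q) = s * Δ ^ q * h := by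
    rw [← mul_assoc, e, mul_assoc, mul_assoc, (delta_zpow_comm hq h).eq]
  generalize s * Δ ^ q = s at hs e'
  obtain ⟨r, hr⟩ := exists_le_zpow s
  let f : ℕ → {s : G | 1 ≤ s ∧ s ≤ Δ ^ r} := fun i =>
    ⟨(orb u g (m * i))⁻¹ * s * orb u h (m * i), orb_transport hs hr e' _⟩
  have := (finite_Icc_one (Δ ^ r)).to_subtype
  obtain ⟨i, j, hij, hf⟩ := Finite.exists_ne_map_eq_of_infinite f
  wlog hlt : i < j generalizing i j
  · exact this j i hij.symm hf.symm (by omega)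
  have hf' : (orb u g (m * i))⁻¹ * s * orb u h (m * i) =
    (orb u g (m * j))⁻¹ * s * orb u h (m * j) := congrArg Subtype.val hf
  obtain ⟨d, rfl⟩ := Nat.exists_eq_add_of_lt hlt
  have hgi := iterate_mul_eq_self hg i
  have hhi := iterate_mul_eq_self hh i
  rw [show m * (i + d + 1) = m * i + m * (d + 1) by ring, orb_add, orb_add, hgi, hhi] at hf'
  refine ⟨d + 1, by omega, (orb u g (m * i))⁻¹ * s * orb u h (m * i), ?_, ?_⟩
  · have h1 := (commute_orb hgi).inv_left.eq.symm
    have h2 := (commute_orb hhi).eq.symm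
    calc g * ((orb u g (m * i))⁻¹ * s * orb u h (m * i))
        = (orb u g (m * i))⁻¹ * (g * s) * orb u h (m * i) := by
          rw [← mul_assoc, ← mul_assoc, h1]; simp only [mul_assoc]
      _ = (orb u g (m * i))⁻¹ * s * (h * orb u h (m * i)) := by rw [e']; simp only [mul_assoc]
      _ = _ := by rw [h2]; simp only [mul_assoc]
  · nth_rw 1 [hf']
    simp only [mul_inv_rev, mul_assoc]
    rw [mul_inv_cancel_left]

/-- An element that is fixed by an iterate of cycling has the maximal infimum of its conjugacy
class. -/
theorem zpow_succ_le_of_conj {u : ℤ} {g h s : G} (e : g * s = s * h) {m : ℕ} (hm : 0 < m)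
    (hg : (cyc u)^[m] g = g) (hh : Δ ^ (u + 1) ≤ h) : Δ ^ (u + 1) ≤ g := by
  have horb : ∀ j, orb u h j = Δ ^ (j : ℤ) := fun j => by
    refine le_antisymm (orb_le_delta_pow _ _ _) (le_orb_iff.2 fun i _ => ?_)
    rw [le_mul_zpow_iff, ← zpow_add]
    simpa using zpow_le_pow hh i
  -- cycling conjugates `h` by `Δ`, and `Δ²` is central
  have hm2 : (cyc u)^[2 * m] h = h := by
    rw [cyc_iterate, horb, mul_assoc, ← (delta_zpow_comm (by simp) h).eq, inv_mul_cancel_left]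
  have hg2 : (cyc u)^[2 * m] g = g := by rw [mul_comm]; exact iterate_mul_eq_self hg 2
  obtain ⟨i, hi, t, -, ht⟩ := exists_periodic_transport e hg2 hm2
  obtain ⟨N, hN⟩ : ∃ N, 2 * m * i = 1 + N := ⟨2 * m * i - 1, by
    have : 0 < 2 * m * i := by positivity
    omega⟩
  rw [hN, horb] at ht
  have hw := congrArg wt ht
  have h2 := wt_le_wt (orb_le_delta_pow u ((cyc u)^[1] g) N)
  rw [orb_add, orb_one] at hw
  simp only [wt_mul, wt_zpow] at hw h2
  push_cast at hw
  -- over a period, the product of the initial factors of `g` has the weight of the power of `Δ`,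
  -- while each factor is at most `Δ`
  have h3 : init u g = Δ := eq_of_le_of_wt_le inf_le_right (by linarith)
  have h4 : Δ ≤ g * Δ ^ (-u) := h3.symm.le.trans inf_le_left
  rw [le_mul_zpow_iff, neg_neg] at h4
  rwa [add_comm, zpow_add, zpow_one]

/-- For an element that is fixed by an iterate of cycling, the meet in `le_orb_iff` is attained by
its two extreme terms. Indeed, if `q` is the product of the initial factors over a long period,
then `q` commutes with `g`, and left multiplication by `q` turns `c ≤ 1` into `q c ≤ q`, which is a
condition on the powers of `g` only. -/
theorem le_orb_of_periodic {u : ℤ} {g c : G} {m : ℕ} (hm : 0 < m) (hg : (cyc u)^[m] g = g) {j : ℕ}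
    (h1 : c ≤ g ^ j * Δ ^ (-(j * u) : ℤ)) (h2 : c ≤ Δ ^ (j : ℤ)) : c ≤ orb u g j := by
  rw [le_orb_iff]
  intro i hi
  have hR := iterate_mul_eq_self hg j
  have hjR : j ≤ m * j := Nat.le_mul_of_pos_left j hm
  generalize m * j = R at hR hjR
  have hcomm := commute_orb hR
  set q := orb u g R with hq
  have hpow : ∀ i l : ℕ, l ≤ R → g ^ i * q ≤ g ^ (i + l) * Δ ^ (R - l * (u + 1) : ℤ) := by
    intro i l hl
    rw [pow_add, mul_assoc]
    exact mul_le_mul_right (orb_le_pow_mul hl) _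
  have claim : ∀ t : ℕ, t ≤ R + j → q * c ≤ g ^ t * Δ ^ (R + j - t * (u + 1) : ℤ) := by
    intro t ht
    rcases Nat.lt_or_ge R t with hRt | hRt
    · obtain ⟨l, rfl⟩ := Nat.exists_eq_add_of_le (hjR.trans hRt.le)
      refine (mul_le_mul_right h1 q).trans ?_
      rw [← mul_assoc, (hcomm.pow_right j).eq]
      refine (mul_zpow_le (hpow j l (by omega)) _).trans_eq ?_
      rw [mul_assoc, ← zpow_add]
      push_cast
      ring_nf
    · refine (mul_le_mul_right h2 q).trans ?_
      refine (mul_zpow_le (orb_le_pow_mul hRt) _).trans_eq ?_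
      rw [mul_assoc, ← zpow_add]
      ring_nf
  have key : q * ((g ^ i)⁻¹ * c * Δ ^ (-(j - i * (u + 1)) : ℤ)) ≤ q := by
    refine le_orb_iff.2 fun l hl => ?_
    rw [← mul_assoc, ← mul_assoc, ((hcomm.pow_right i).inv_right).eq, mul_assoc _ q,
      mul_zpow_le_iff, inv_mul_le_iff_le_mul]
    refine (claim (i + l) (by omega)).trans_eq ?_
    rw [pow_add]
    simp only [mul_assoc, ← zpow_add]
    push_cast
    ring_nf
  rwa [mul_le_iff_le_one_right', mul_zpow_le_iff, neg_neg, one_mul, inv_mul_le_iff_le_mul] at key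

/-- If the first `k` iterated cyclings use up all factors of `x`, they conjugate `x` by a power of
`Δ`, and so the same holds for the powers of `x`. -/
theorem orb_mul_of_orb_eq {u : ℤ} {k : ℕ} {x : G} (hx : orb u x k = x * Δ ^ (-u)) (m : ℕ) :
    orb u x (k * m) = x ^ m * Δ ^ (-(m * u) : ℤ) := by
  have hxk : (cyc u)^[k] x = Δ ^ u * x * Δ ^ (-u) := by
    rw [cyc_iterate, hx]; group
  induction m with
  | zero => simp [orb]
  | succ m ih =>
    rw [show k * (m + 1) = k + k * m by ring, orb_add, hx, hxk, orb_conj, ih, pow_succ']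
    rw [show (-((m + 1 : ℕ) * u) : ℤ) = -(m * u) + -u by push_cast; ring]
    simp only [mul_assoc, zpow_add, zpow_neg, inv_mul_cancel_left]

theorem iterate_cyc_of_orb_eq {u : ℤ} {k : ℕ} {x : G} (hx : orb u x k = x * Δ ^ (-u)) (m : ℕ) :
    (cyc u)^[k * (2 * m)] x = x := by
  have hev : Even (-((2 * m : ℕ) * u) : ℤ) := by simp [mul_assoc]
  have h : Commute (x ^ (2 * m) * Δ ^ (-((2 * m : ℕ) * u) : ℤ)) x :=
    (Commute.refl x).pow_left _ |>.mul_left (delta_zpow_comm hev x)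
  rw [cyc_iterate, orb_mul_of_orb_eq hx, mul_assoc, ← h.eq, inv_mul_cancel_left]

/-- Let `x` be a rigid element of canonical length `k ≥ 2` and infimum `u`, in the sense that the
first `k` iterated cyclings use up all factors of `x`. If a conjugate `y` of `x` is fixed by an
iterate of cycling, has infimum at least `u` and supremum at most `u + k`, then the first `k`
factors of `y²` are already given by `y`. For some `m > 0`, transport shows that the first `k m`
iterated cyclings of `y` use up all factors of `yᵐ`, and then `le_orb_of_periodic` implies that the
first `k m` factors of `yᵐ⁺¹` are given by `yᵐ`; here `m + 1 ≤ k m` is needed. -/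
theorem le_of_le_sq {u : ℤ} {k : ℕ} (hk : 2 ≤ k) {x y s : G} (e : x * s = s * y)
    (hx : orb u x k = x * Δ ^ (-u)) {M : ℕ} (hM : 0 < M) (hy : (cyc u)^[M] y = y)
    (hinf : Δ ^ u ≤ y) (hsup : y ≤ Δ ^ (u + k)) {c : G}
    (h1 : c ≤ y ^ 2 * Δ ^ (-(2 * u))) (h2 : c ≤ Δ ^ (k : ℤ)) : c ≤ y * Δ ^ (-u) := by
  have hxT : (cyc u)^[k * (2 * M)] x = x := iterate_cyc_of_orb_eq hx M
  have hyT : (cyc u)^[k * (2 * M)] y = y := by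
    rw [show k * (2 * M) = M * (2 * k) by ring]; exact iterate_mul_eq_self hy _
  obtain ⟨i, hi, t, hxy, ht⟩ := exists_periodic_transport e hxT hyT
  obtain ⟨m, hm, hmev⟩ : ∃ m, 2 * M * i = m + 1 ∧ Even (m + 1) := by
    have : 0 < 2 * M * i := by positivity
    refine ⟨2 * M * i - 1, by omega, ?_⟩
    rw [show 2 * M * i - 1 + 1 = 2 * (M * i) by rw [← mul_assoc]; omega]
    simp
  have hev : Even (-((m + 1 : ℕ) * u) : ℤ) := by
    rw [even_neg]; exact Even.mul_right (by exact_mod_cast hmev) u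
  rw [mul_assoc k, hm, orb_mul_of_orb_eq hx, mul_assoc, (delta_zpow_comm hev t).eq, ← mul_assoc,
    ← ((show SemiconjBy t y x from hxy.symm).pow_right (m + 1)).eq, mul_assoc,
    mul_right_inj] at ht
  have hyT' := iterate_mul_eq_self hyT i
  rw [mul_assoc k, hm] at hyT'
  have hkm : m + 2 ≤ k * (m + 1) := by nlinarith
  -- `yᵐ c` divides `yᵐ⁺²`, hence a sufficiently long power of `y`, as `m + 2 ≤ k (m + 1)`; and
  -- it divides a power of `Δ` because `y` has at most `k` factors
  have key : y ^ m * c * Δ ^ (-(m * u) : ℤ) ≤ orb u y (k * (m + 1)) := by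
    refine le_orb_of_periodic (m := M) hM hy ?_ ?_
    · obtain ⟨d, hd⟩ := Nat.exists_eq_add_of_le hkm
      have h3 : 1 ≤ y ^ d * Δ ^ (-(d * u) : ℤ) := by
        rw [le_mul_zpow_iff, neg_neg, one_mul]; exact zpow_le_pow hinf d
      have h4 := mul_zpow_le (mul_le_mul_right h1 (y ^ m)) (-(m * u) : ℤ)
      refine h4.trans ?_
      rw [hd, pow_add, pow_add, mul_assoc, mul_assoc, mul_assoc, mul_assoc]
      refine mul_le_mul_right (mul_le_mul_right ?_ _) _
      have h5 := mul_zpow_le h3 (-(2 * u) + -(m * u) : ℤ)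
      rw [one_mul, zpow_add] at h5
      refine h5.trans_eq ?_
      rw [← zpow_add, mul_assoc, ← zpow_add]
      push_cast
      ring_nf
    · have h3 := mul_zpow_le (mul_le_mul_right h2 (y ^ m)) (-(m * u) : ℤ)
      refine h3.trans ?_
      rw [mul_assoc, ← zpow_add]
      refine (mul_zpow_le (pow_le_zpow hsup m) _).trans_eq ?_
      rw [← zpow_add]
      push_cast
      ring_nf
  rw [← ht, mul_zpow_le_iff, neg_neg, pow_succ, mul_assoc, mul_assoc, mul_le_mul_iff_left,
    ← zpow_add] at key
  refine key.trans_eq ?_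
  congr 2
  push_cast
  ring

/-! ### Normal forms -/

/-- The product `a b` of simple elements is left weighted: `a` is its largest simple left
factor. -/
def LeftWeighted (a b : G) : Prop := ∀ c, c ≤ a * b → c ≤ Δ → c ≤ a

theorem LeftWeighted.conj {a b : G} (h : LeftWeighted a b) (z : ℤ) :
    LeftWeighted (Δ ^ z * a * Δ ^ (-z)) (Δ ^ z * b * Δ ^ (-z)) := by
  intro c h1 h2
  rw [le_mul_zpow_iff, neg_neg, ← neg_neg z, ← zpow_mul_le_iff, neg_neg]
  refine h _ ?_ ?_
  · rw [zpow_mul_le_iff, neg_neg, mul_zpow_le_iff]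
    refine h1.trans_eq ?_
    group
  · rw [zpow_mul_le_iff, neg_neg, mul_zpow_le_iff]
    refine h2.trans_eq ?_
    group

theorem delta_le_mul_delta {a : G} (h : 1 ≤ a) : Δ ≤ a * Δ := by
  simpa using zpow_le_mul_zpow h 1

/-- Conjugation by a power of the Garside element. -/
def twist (u : ℤ) (a : G) : G := Δ ^ u * a * Δ ^ (-u)

theorem twist_mul (u : ℤ) (a b : G) : twist u (a * b) = twist u a * twist u b := by
  unfold twist; group

theorem twist_list_prod (u : ℤ) (l : List G) : twist u l.prod = (l.map (twist u)).prod := by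
  induction l with
  | nil => simp [twist]
  | cons a t ih => rw [List.prod_cons, twist_mul, ih, List.map_cons, List.prod_cons]

theorem twist_le_twist {u : ℤ} {a b : G} (h : a ≤ b) : twist u a ≤ twist u b :=
  mul_zpow_le (mul_le_mul_right h _) _

theorem twist_one (u : ℤ) : twist u (1 : G) = 1 := by simp [twist]

theorem twist_delta (u : ℤ) : twist u Δ = Δ := by unfold twist; group

theorem twist_neg_twist (u : ℤ) (a : G) : twist (-u) (twist u a) = a := by unfold twist; group

theorem twist_zero (a : G) : twist 0 a = a := by simp [twist]

theorem twist_twist (u v : ℤ) (a : G) : twist u (twist v a) = twist (u + v) a := by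
  unfold twist; group

theorem twist_zpow (u z : ℤ) : twist u (Δ ^ z) = Δ ^ z := by unfold twist; group

theorem twist_simple (u : ℤ) {a : G} (h : 1 ≤ a ∧ a ≤ Δ) : 1 ≤ twist u a ∧ twist u a ≤ Δ :=
  ⟨twist_one (G := G) u ▸ twist_le_twist h.1, twist_delta (G := G) u ▸ twist_le_twist h.2⟩

theorem chain_map_twist (u : ℤ) {l : List G} (h : l.IsChain LeftWeighted) :
    (l.map (twist u)).IsChain LeftWeighted :=
  List.isChain_map_of_isChain (twist u) (fun _ _ hab => LeftWeighted.conj hab u) h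

theorem prod_le_zpow {l : List G} (h : ∀ a ∈ l, 1 ≤ a ∧ a ≤ Δ) : l.prod ≤ Δ ^ (l.length : ℤ) := by
  induction l with
  | nil => simp
  | cons a t ih =>
    simp only [List.forall_mem_cons] at h
    rw [List.prod_cons]
    refine (mul_le_mul_right (ih h.2) a).trans ?_
    refine (mul_zpow_le h.1.2 _).trans_eq ?_
    rw [← zpow_one_add, List.length_cons]
    push_cast
    ring_nf

theorem prod_mul_delta_le {l : List G} (h : ∀ a ∈ l, 1 ≤ a ∧ a ≤ Δ) :
    l.prod * Δ ≤ Δ ^ (l.length + 1 : ℤ) := by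
  simpa [zpow_add_one] using mul_zpow_le (prod_le_zpow h) 1

theorem one_le_prod {l : List G} (h : ∀ a ∈ l, 1 ≤ a ∧ a ≤ Δ) : 1 ≤ l.prod :=
  List.one_le_prod_of_one_le fun a ha => (h a ha).1

/-- The first factor of a left weighted product is its largest simple left factor. -/
theorem le_head_of_chain {a : G} {t : List G} (h : ∀ b ∈ a :: t, 1 ≤ b ∧ b ≤ Δ)
    (hc : (a :: t).IsChain LeftWeighted) {c : G} (h1 : c ≤ (a :: t).prod) (h2 : c ≤ Δ) : c ≤ a := by
  induction t generalizing a c with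
  | nil => simpa using h1
  | cons b t ih =>
    rw [List.isChain_cons_cons] at hc
    rw [List.forall_mem_cons] at h
    rw [List.prod_cons, ← inv_mul_le_iff_le_mul] at h1
    refine hc.1 c (inv_mul_le_iff_le_mul.1 (ih h.2 hc.2 h1 ?_)) h2
    exact inv_mul_le_iff_le_mul.2 (h2.trans (delta_le_mul_delta h.1.1))

/-- The product of the first `j` factors of a left weighted product is its meet with `Δʲ`. -/
theorem le_prefix_of_chain {p q : List G} (h : ∀ b ∈ p ++ q, 1 ≤ b ∧ b ≤ Δ)
    (hc : (p ++ q).IsChain LeftWeighted) {c : G} (h1 : c ≤ (p ++ q).prod)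
    (h2 : c ≤ Δ ^ (p.length : ℤ)) : c ≤ p.prod := by
  induction p generalizing c with
  | nil => simpa using h2
  | cons a p ih =>
    rw [List.cons_append] at h hc h1
    have hhead : c ⊓ Δ ≤ a := le_head_of_chain h hc (inf_le_left.trans h1) inf_le_right
    have hcle : c ≤ (c ⊓ Δ) * Δ ^ (p.length : ℤ) := by
      rw [le_mul_zpow_iff, le_inf_iff]
      constructor
      · rw [← le_mul_zpow_iff]
        exact le_mul_of_one_le_right' (by simpa using zpow_le_zpow (Int.natCast_nonneg p.length))
      · rw [← le_mul_zpow_iff]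
        refine h2.trans_eq ?_
        rw [List.length_cons, Nat.cast_succ, add_comm, zpow_add, zpow_one]
    rw [List.prod_cons, ← inv_mul_le_iff_le_mul] at h1 ⊢
    rw [List.forall_mem_cons] at h
    refine ih h.2 hc.of_cons h1 (inv_mul_le_iff_le_mul.2 ?_)
    exact hcle.trans (mul_zpow_le hhead _)

/-- `g = Δᵘ x₁ ⋯ x_k` with `l = [x₁, …, x_k]` is the left normal form of `g`. -/
structure IsNormalForm (g : G) (u : ℤ) (l : List G) : Prop where
  eq : g = Δ ^ u * l.prod
  simple : ∀ a ∈ l, 1 ≤ a ∧ a ≤ Δ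
  ne_one : ∀ a ∈ l, a ≠ 1
  ne_delta : ∀ a ∈ l, a ≠ Δ
  chain : l.IsChain LeftWeighted

theorem IsNormalForm.zpow_le_iff {g : G} {u : ℤ} {l : List G} (h : IsNormalForm g u l) {v : ℤ} :
    Δ ^ v ≤ g ↔ v ≤ u := by
  constructor
  · intro hv
    by_contra! hlt
    have h1 : Δ ^ (u + 1) ≤ Δ ^ u * l.prod := h.eq ▸ (zpow_le_zpow hlt).trans hv
    rw [zpow_add, zpow_one, mul_le_mul_iff_left] at h1
    cases l with
    | nil => exact delta_ne_one (le_antisymm h1 one_le_delta)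
    | cons a t =>
      exact h.ne_delta a (by simp)
        (le_antisymm (h.simple a (by simp)).2 (le_head_of_chain h.simple h.chain h1 le_rfl))
  · intro hv
    rw [h.eq]
    exact (zpow_le_zpow hv).trans (le_mul_of_one_le_right' (one_le_prod h.simple))

theorem IsNormalForm.le_zpow_iff {g : G} {u : ℤ} {l : List G} (h : IsNormalForm g u l) {v : ℤ} :
    g ≤ Δ ^ v ↔ u + l.length ≤ v := by
  constructor
  · intro hv
    by_contra! hlt
    rcases List.eq_nil_or_concat' l with rfl | ⟨p, t, rfl⟩
    · rw [h.eq] at hv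
      simp only [List.prod_nil, mul_one, zpow_le_zpow_iff] at hv
      simp at hlt
      omega
    · rw [List.length_append, List.length_singleton] at hlt
      push_cast at hlt
      have h1 := hv.trans (zpow_le_zpow (show v ≤ u + p.length by omega))
      rw [h.eq, zpow_add, mul_le_mul_iff_left] at h1
      have h2 := le_prefix_of_chain h.simple h.chain le_rfl h1
      rw [List.prod_append, List.prod_singleton, mul_le_iff_le_one_right'] at h2
      exact h.ne_one t (by simp) (le_antisymm h2 (h.simple t (by simp)).1)
  · intro hv
    rw [h.eq]
    refine (mul_le_mul_right (prod_le_zpow h.simple) _).trans ?_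
    rw [← zpow_add]
    exact zpow_le_zpow hv

/-- In terms of a factorization with the power of `Δ` at the end, `init` is the first factor. -/
theorem init_eq_of_chain {u : ℤ} {a : G} {t : List G} (h : ∀ b ∈ a :: t, 1 ≤ b ∧ b ≤ Δ)
    (hc : (a :: t).IsChain LeftWeighted) : init u ((a :: t).prod * Δ ^ u) = a := by
  rw [init, mul_assoc, ← zpow_add, add_neg_cancel, zpow_zero, mul_one]
  rw [List.forall_mem_cons] at h
  refine le_antisymm (le_head_of_chain (List.forall_mem_cons.2 h) hc inf_le_left inf_le_right)
    (le_inf ?_ h.1.2)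
  rw [List.prod_cons]
  exact le_mul_of_one_le_right' (one_le_prod h.2)

/-- Cycling rotates the list of factors of a rigid element. -/
theorem orb_eq_prod_of_chain {u : ℤ} (p : List G) {q : List G}
    (h : ∀ b ∈ p ++ q, 1 ≤ b ∧ b ≤ Δ)
    (hc : (p ++ q ++ p.map (twist u)).IsChain LeftWeighted) :
    orb u ((p ++ q).prod * Δ ^ u) p.length = p.prod := by
  induction p generalizing q with
  | nil => simp [orb]
  | cons a p ih =>
    have hinit : init u ((a :: p ++ q).prod * Δ ^ u) = a := by
      rw [List.cons_append] at h hc ⊢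
      exact init_eq_of_chain h (List.isChain_append.1 hc).1
    have hcyc : cyc u ((a :: p ++ q).prod * Δ ^ u) =
        (p ++ (q ++ [twist u a])).prod * Δ ^ u := by
      rw [cyc, hinit]
      simp only [List.cons_append, List.prod_cons, List.prod_append, List.prod_nil, twist]
      group
    rw [List.length_cons, add_comm, orb_add, orb_one, hinit, Function.iterate_one, hcyc, ih,
      List.prod_cons]
    · intro b hb
      rw [← List.append_assoc, List.mem_append, List.mem_singleton] at hb
      rcases hb with hb | rfl
      · exact h b (by simpa using Or.inr (by simpa using hb))
      · exact twist_simple u (h a (by simp))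
    · simpa using (List.IsChain.of_cons (by simpa using hc) :
        (p ++ (q ++ (twist u a :: p.map (twist u)))).IsChain LeftWeighted)

/-- The last factor of `l` and the first factor of `l`, carried around through `Δᵘ`, are left
weighted. For the factors of a normal form this is rigidity. -/
def WrapsAround (u : ℤ) (l : List G) : Prop :=
  ∀ t ∈ l.getLast?, ∀ a ∈ l.head?, LeftWeighted t (twist u a)

theorem IsNormalForm.eq_prod_twist {g : G} {u : ℤ} {l : List G} (h : IsNormalForm g u l) :
    g = (l.map (twist u)).prod * Δ ^ u := by
  rw [← twist_list_prod, h.eq, twist]; group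

theorem IsNormalForm.orb_eq_of_wrapsAround {g : G} {u : ℤ} {l : List G} (h : IsNormalForm g u l)
    (hw : WrapsAround u l) : orb u g l.length = g * Δ ^ (-u) := by
  have hsimple : ∀ b ∈ l.map (twist u) ++ [], 1 ≤ b ∧ b ≤ Δ := by
    simp only [List.append_nil, List.forall_mem_map]
    exact fun b hb => twist_simple u (h.simple b hb)
  have hc : (l.map (twist u) ++ [] ++ (l.map (twist u)).map (twist u)).IsChain LeftWeighted := by
    rw [List.append_nil, List.isChain_append]
    refine ⟨chain_map_twist u h.chain, chain_map_twist u (chain_map_twist u h.chain), ?_⟩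
    simp only [List.getLast?_map, List.head?_map, Option.mem_def, Option.map_eq_some_iff]
    rintro _ ⟨t, ht, rfl⟩ _ ⟨_, ⟨a, ha, rfl⟩, rfl⟩
    exact (hw t ht a ha).conj u
  have h1 := orb_eq_prod_of_chain (u := u) (l.map (twist u)) hsimple hc
  rw [List.append_nil, List.length_map, ← h.eq_prod_twist] at h1
  rw [h1]
  conv_rhs => rw [h.eq_prod_twist]
  group

theorem IsNormalForm.init_eq {g a : G} {u : ℤ} {t : List G} (h : IsNormalForm g u (a :: t)) :
    init u g = twist u a := by
  have h2 := h.eq_prod_twist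
  rw [List.map_cons] at h2
  rw [h2]
  refine init_eq_of_chain ?_ ?_
  · rw [← List.map_cons, List.forall_mem_map]
    exact fun b hb => twist_simple u (h.simple b hb)
  · rw [← List.map_cons]
    exact chain_map_twist u h.chain

theorem IsNormalForm.init_nil {g : G} {u : ℤ} (h : IsNormalForm g u []) : init u g = 1 := by
  rw [init, h.eq]
  simpa using one_le_delta

/-- The initial factor of the inverse of `g` is the complement of the last factor of `g`; so the
decycling of `g` is, up to conjugation by `Δ`, the inverse of the cycling of `g⁻¹`. -/
theorem IsNormalForm.init_inv {g t : G} {u : ℤ} {p : List G} (h : IsNormalForm g u (p ++ [t])) :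
    init (-(u + (p ++ [t]).length)) g⁻¹ = t⁻¹ * Δ := by
  have ht := h.simple t (by simp)
  have hp : ∀ a ∈ p, 1 ≤ a ∧ a ≤ Δ := fun a ha => h.simple a (by simp [ha])
  have hg : g = Δ ^ u * p.prod * t := by rw [h.eq, List.prod_append, List.prod_singleton, mul_assoc]
  rw [init, neg_neg, List.length_append, List.length_singleton]
  refine le_antisymm ?_ (le_inf ?_ ?_)
  · set c := g⁻¹ * Δ ^ (u + (p.length + 1 : ℕ)) ⊓ Δ with hcdef
    have h1 : c ≤ g⁻¹ * Δ ^ (u + (p.length + 1 : ℕ)) := inf_le_left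
    have h2 : c ≤ Δ := inf_le_right
    rw [le_inv_mul_iff_mul_le] at h1
    have h3 : Δ ^ (-u) * g * c * Δ ^ (-1 : ℤ) ≤ p.prod := by
      refine le_prefix_of_chain h.simple h.chain ?_ ?_
      · rw [mul_zpow_le_iff, neg_neg, zpow_one, show (p ++ [t]).prod = Δ ^ (-u) * g by
          rw [h.eq]; group]
        exact mul_le_mul_right h2 _
      · rw [mul_zpow_le_iff, mul_assoc, zpow_mul_le_iff]
        refine h1.trans_eq ?_
        rw [← zpow_add, ← zpow_add]
        push_cast
        ring_nf
    rw [hg, zpow_neg] at h3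
    simp only [mul_assoc, inv_mul_cancel_left] at h3
    rw [mul_le_iff_le_one_right', ← mul_assoc, mul_zpow_le_iff, neg_neg, zpow_one, one_mul] at h3
    exact le_inv_mul_iff_mul_le.2 h3
  · rw [le_inv_mul_iff_mul_le, hg, mul_assoc, mul_inv_cancel_left, mul_assoc, zpow_add]
    exact mul_le_mul_right (by exact_mod_cast prod_mul_delta_le hp) _
  · rw [inv_mul_le_iff_le_mul]
    exact delta_le_mul_delta ht.1

theorem IsNormalForm.init_inv_nil {g : G} {u : ℤ} (h : IsNormalForm g u []) :
    init (-u) g⁻¹ = 1 := by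
  rw [init, h.eq]
  simpa using one_le_delta

theorem exists_isNormalForm_of_pos {g : G} (hg : 1 ≤ g) (hd : ¬ Δ ≤ g) :
    ∃ l, IsNormalForm g 0 l := by
  obtain ⟨m, hm⟩ : ∃ m : ℕ, wt g = m := ⟨(wt g).toNat, by
    have := wt_le_wt hg
    rw [wt_one] at this
    omega⟩
  induction m using Nat.strong_induction_on generalizing g with
  | _ m ih =>
    rcases eq_or_ne g 1 with rfl | hne
    · exact ⟨[], by simp, by simp, by simp, by simp, by simp⟩
    have ha1 : g ⊓ Δ ≠ 1 := by
      intro h1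
      obtain ⟨b, hb, hb1, hba, hbd⟩ := exists_simple g (one_le_iff.1 hg) hne
      rw [← le_def] at hba hbd
      exact hb1 (le_antisymm (h1 ▸ le_inf hba hbd) (one_le_iff.2 hb))
    have ha : 1 ≤ g ⊓ Δ := le_inf hg one_le_delta
    obtain ⟨h, hh⟩ : ∃ h, g = (g ⊓ Δ) * h := ⟨(g ⊓ Δ)⁻¹ * g, by simp⟩
    have h1 : 1 ≤ h := by
      have : (g ⊓ Δ) * 1 ≤ (g ⊓ Δ) * h := by rw [mul_one, ← hh]; exact inf_le_left
      exact le_of_mul_le_mul_left' this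
    have hhd : ¬ Δ ≤ h := by
      intro hh'
      refine hd ((delta_le_mul_delta ha).trans ?_)
      nth_rw 2 [hh]
      exact mul_le_mul_right hh' _
    have hw : wt (g ⊓ Δ) > 0 := by
      by_contra! hle
      exact ha1 (eq_of_le_of_wt_le ha (by simpa using hle)).symm
    have hw' := congrArg wt hh
    rw [wt_mul] at hw'
    have hw'' := wt_le_wt h1
    rw [wt_one] at hw''
    obtain ⟨l, hl⟩ := ih (wt h).toNat (by omega) h1 hhd (by omega)
    have hhl : h = l.prod := by simpa using hl.eq
    refine ⟨(g ⊓ Δ) :: l, ?_, ?_, ?_, ?_, ?_⟩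
    · rw [zpow_zero, one_mul, List.prod_cons, ← hhl, ← hh]
    · exact List.forall_mem_cons.2 ⟨⟨ha, inf_le_right⟩, hl.simple⟩
    · exact List.forall_mem_cons.2 ⟨ha1, hl.ne_one⟩
    · exact List.forall_mem_cons.2 ⟨fun e => hd (e ▸ inf_le_left), hl.ne_delta⟩
    · refine List.IsChain.cons hl.chain ?_
      intro b hb c hc hcd
      refine le_inf (hc.trans ?_) hcd
      obtain ⟨t, rfl⟩ : ∃ t, l = b :: t := by
        cases l with
        | nil => simp at hb
        | cons b' t => exact ⟨t, by simpa using hb⟩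
      nth_rw 2 [hh]
      rw [hhl, List.prod_cons]
      exact mul_le_mul_right (le_mul_of_one_le_right'
        (one_le_prod (List.forall_mem_cons.1 hl.simple).2)) _

theorem exists_isNormalForm (g : G) : ∃ u l, IsNormalForm g u l := by
  obtain ⟨r, hr⟩ := exists_zpow_le g
  obtain ⟨R, hR⟩ := exists_le_zpow g
  obtain ⟨u, hu, hmax⟩ := Int.exists_greatest_of_bdd (P := fun u => Δ ^ u ≤ g)
    ⟨R, fun z hz => zpow_le_zpow_iff.1 (hz.trans hR)⟩ ⟨r, hr⟩
  obtain ⟨l, hl⟩ := exists_isNormalForm_of_pos (g := Δ ^ (-u) * g)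
    (by rwa [zpow_neg, le_inv_mul_iff_mul_le, mul_one]) (fun h => by
      rw [zpow_neg, le_inv_mul_iff_mul_le, ← zpow_add_one] at h
      have := hmax _ h
      omega)
  refine ⟨u, l, ?_, hl.simple, hl.ne_one, hl.ne_delta, hl.chain⟩
  have := hl.eq
  rw [zpow_neg, zpow_zero, one_mul, inv_mul_eq_iff_eq_mul] at this
  exact this

/-! ### Rigid elements -/

theorem zpow_le_inv_iff {g : G} {z : ℤ} : Δ ^ z ≤ g⁻¹ ↔ g ≤ Δ ^ (-z) := by
  rw [← one_mul (Δ ^ z), mul_zpow_le_iff, le_inv_mul_iff_mul_le, mul_one]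

/-- If `x` is rigid with at least two factors, then so is every conjugate `y` for which both `y` and
`y⁻¹` are fixed by an iterate of cycling. The conditions on `y` force the infimum of `y` to be that
of `x`, and the supremum of `y` to be at most that of `x`. -/
theorem wrapsAround_of_conj {x y s : G} {u v : ℤ} {l l' : List G} (hx : IsNormalForm x u l)
    (hlen : 2 ≤ l.length) (hw : WrapsAround u l) (hy : IsNormalForm y v l') (e : x * s = s * y)
    {M N : ℕ} (hM : 0 < M) (hN : 0 < N) (hcyc : (cyc v)^[M] y = y)
    (hdec : (cyc (-(v + l'.length)))^[N] y⁻¹ = y⁻¹) :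
    l' ≠ [] ∧ WrapsAround v l' := by
  have hxorb := hx.orb_eq_of_wrapsAround hw
  have e' : y * s⁻¹ = s⁻¹ * x := by
    rw [eq_inv_mul_iff_mul_eq, ← mul_assoc, ← e, mul_inv_cancel_right]
  have e'' : y⁻¹ * s⁻¹ = s⁻¹ * x⁻¹ := by rw [← mul_inv_rev, ← e, mul_inv_rev]
  obtain rfl : v = u := by
    refine le_antisymm ?_ ?_ <;> by_contra! hlt
    · have := zpow_succ_le_of_conj e (by positivity) (iterate_cyc_of_orb_eq hxorb 1)
        (hy.zpow_le_iff.2 hlt)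
      have := hx.zpow_le_iff.1 this
      omega
    · have := zpow_succ_le_of_conj e' hM hcyc (hx.zpow_le_iff.2 hlt)
      have := hy.zpow_le_iff.1 this
      omega
  have hlen' : l'.length ≤ l.length := by
    by_contra! hlt
    have h1 := zpow_succ_le_of_conj e'' hN hdec
      (zpow_le_inv_iff.2 (hx.le_zpow_iff.2 (by omega)))
    have h2 := hy.le_zpow_iff.1 (zpow_le_inv_iff.1 h1)
    omega
  constructor
  · rintro rfl
    have h1 := congrArg wt e
    rw [wt_mul, wt_mul, hx.eq, hy.eq] at h1
    simp only [wt_mul, List.prod_nil, wt_one] at h1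
    have h2 : 1 = l.prod := eq_of_le_of_wt_le (one_le_prod hx.simple) (by rw [wt_one]; omega)
    cases l with
    | nil => simp at hlen
    | cons a t =>
      have h3 := List.forall_mem_cons.1 hx.simple
      refine hx.ne_one a (by simp) (le_antisymm ?_ h3.1.1)
      rw [h2, List.prod_cons]
      exact le_mul_of_one_le_right' (one_le_prod h3.2)
  · intro t ht a ha c hc hcd
    -- replacing the last factor `t` of `y` by `c` gives an element dividing `y²` with at most as
    -- many factors as `x`, to which `le_of_le_sq` applies
    obtain ⟨p, rfl⟩ : ∃ p, l' = p ++ [t] := List.getLast?_eq_some_iff.1 ht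
    obtain ⟨q, hq⟩ : ∃ q, p ++ [t] = a :: q := List.head?_eq_some_iff.1 ha
    have hp : ∀ a ∈ p, 1 ≤ a ∧ a ≤ Δ := fun a ha => hy.simple a (by simp [ha])
    have hyt : y = Δ ^ v * p.prod * t := by
      rw [hy.eq, List.prod_append, List.prod_singleton, mul_assoc]
    have hya : Δ ^ v * a ≤ y := by
      rw [hy.eq, hq, List.prod_cons]
      rw [hq] at hy
      exact mul_le_mul_right (le_mul_of_one_le_right'
        (one_le_prod (List.forall_mem_cons.1 hy.simple).2)) _
    have key : Δ ^ v * p.prod * c * Δ ^ (-v) ≤ y * Δ ^ (-v) := by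
      refine le_of_le_sq hlen e hxorb hM hcyc (hy.zpow_le_iff.2 le_rfl)
        (hy.le_zpow_iff.2 (by omega)) ?_ ?_
      · have h1 := mul_zpow_le (mul_le_mul_right hc (Δ ^ v * p.prod)) (-v)
        have h2 := mul_zpow_le (mul_le_mul_right hya y) (-(2 * v))
        rw [← mul_assoc, ← hyt, twist] at h1
        refine h1.trans ?_
        rw [pow_two]
        refine le_trans (le_of_eq ?_) h2
        group
      · rw [mul_zpow_le_iff, neg_neg]
        refine (mul_le_mul_right hcd _).trans ?_
        rw [mul_assoc]
        refine (mul_le_mul_right (prod_mul_delta_le hp) _).trans ?_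
        rw [← zpow_add, ← zpow_add]
        rw [List.length_append, List.length_singleton] at hlen'
        exact zpow_le_zpow (by omega)
    rw [mul_zpow_le_iff, neg_neg, mul_assoc y, ← zpow_add, neg_add_cancel, zpow_zero, mul_one,
      hyt, mul_le_mul_iff_left] at key
    exact key

end Garside

/-! ### The Garside structure of the braid group -/

namespace BraidTheory

open Garside GarsideStructure

variable {n : ℕ}

theorem braid_closure (n : ℕ) :
    Subgroup.closure (Set.range (PresentedGroup.of : Fin (n - 1) → Braid n)) = ⊤ :=
  PresentedGroup.closure_range_of _

theorem fundamental_conj (x : PosBraid n) :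
    toBraid n (fundamental n) * toBraid n x * (toBraid n (fundamental n))⁻¹ =
      toBraid n (flipHom n x) := by
  rw [← map_mul, fundamental_mul, map_mul, mul_inv_cancel_right]

/-- The exponent sum of a braid. -/
def exponentSum (n : ℕ) : Braid n →* Multiplicative ℤ :=
  PresentedGroup.toGroup (f := fun _ => Multiplicative.ofAdd 1) (by
    rintro r ⟨v, w, h, rfl⟩
    cases h <;> simp [map_mul])

theorem exponentSum_toBraid (x : PosBraid n) :
    exponentSum n (toBraid n x) = Multiplicative.ofAdd (len x : ℤ) := by
  induction x using sigma_mul_induction with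
  | one => simp
  | mul i x ih =>
    rw [map_mul, map_mul, ih, toBraid_sigma, exponentSum, PresentedGroup.toGroup.of, len_mul,
      len_sigma, ← ofAdd_add]
    push_cast
    rfl

theorem finite_len_le (n m : ℕ) : {x : PosBraid n | len x ≤ m}.Finite := by
  refine ((List.finite_length_le (Fin (n - 1)) m).image
    (fun w => PresentedMonoid.mk (ArtinRel n) w)).subset ?_
  intro x hx
  obtain ⟨w, rfl⟩ := PresentedMonoid.surjective_mk x
  rw [Set.mem_ofPred_eq, len_mk] at hx
  exact ⟨w, hx, rfl⟩

theorem inv_toBraid_mul_mem {x y : PosBraid n} :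
    (toBraid n x)⁻¹ * toBraid n y ∈ MonoidHom.mrange (toBraid n) ↔ LeftSubword x y := by
  constructor
  · rintro ⟨z, hz⟩
    refine ⟨z, toBraid_injective n ?_⟩
    rw [map_mul, hz, mul_inv_cancel_left]
  · rintro ⟨z, rfl⟩
    exact ⟨z, by rw [map_mul, inv_mul_cancel_left]⟩

theorem fundamental_ne_one (hn : 2 ≤ n) : fundamental n ≠ 1 := by
  intro h
  have h1 := (sigma_leftSubword_fundamental (n := n) ⟨0, by omega⟩).len_le
  rw [h] at h1
  simp at h1

/-- The classical Garside structure of the braid group. For `n ≤ 1` the group is trivial and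
`Δ = 1`, which a Garside element may not be. -/
noncomputable instance [hn : Fact (2 ≤ n)] : GarsideStructure (Braid n) where
  pos := MonoidHom.mrange (toBraid n)
  delta := toBraid n (fundamental n)
  weight := exponentSum n
  weight_pos := by
    rintro _ ⟨x, rfl⟩ hx
    rw [exponentSum_toBraid, toAdd_ofAdd]
    have : len x ≠ 0 := fun h => hx (by rw [len_eq_zero.1 h, map_one])
    omega
  finite_weight_le m := by
    refine ((finite_len_le n m.toNat).image (toBraid n)).subset ?_
    rintro _ ⟨⟨x, rfl⟩, hx⟩
    rw [exponentSum_toBraid, toAdd_ofAdd] at hx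
    exact ⟨x, by simp only [Set.mem_ofPred_eq]; omega, rfl⟩
  delta_mem := ⟨_, rfl⟩
  delta_ne_one h := fundamental_ne_one hn.out (toBraid_injective n (by rw [h, map_one]))
  conj_delta_mem := by
    rintro _ ⟨x, rfl⟩
    exact ⟨_, (fundamental_conj x).symm⟩
  delta_sq_comm g := by
    have hg : g ∈ Subgroup.closure (Set.range (PresentedGroup.of : Fin (n - 1) → Braid n)) := by
      rw [braid_closure]; trivial
    induction hg using Subgroup.closure_induction with
    | mem _ h =>
      obtain ⟨i, rfl⟩ := h
      have := congrArg (toBraid n) (fundamental_sq_comm (sigma i))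
      simp only [map_mul, toBraid_sigma] at this
      rw [pow_two]
      exact this.symm
    | one => exact Commute.one_right _
    | mul _ _ _ _ h1 h2 => exact h1.mul_right h2
    | inv _ _ h1 => exact h1.inv_right
  exists_mul_mem g := by
    have hconj : ∀ (r : ℕ) (x : PosBraid n), x * fundamental n ^ r =
        fundamental n ^ r * (flipHom n)^[r] x := by
      intro r
      induction r with
      | zero => simp
      | succ r ih =>
        intro x
        rw [pow_succ', ← mul_assoc, mul_fundamental, mul_assoc, ih, Function.iterate_succ_apply,
          mul_assoc]
    have hg : g ∈ Subgroup.closure (Set.range (PresentedGroup.of : Fin (n - 1) → Braid n)) := by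
      rw [braid_closure]; trivial
    induction hg using Subgroup.closure_induction'' with
    | mem _ h =>
      obtain ⟨i, rfl⟩ := h
      exact ⟨0, sigma i, by rw [pow_zero, mul_one, toBraid_sigma]⟩
    | inv_mem _ h =>
      obtain ⟨i, rfl⟩ := h
      rw [← toBraid_sigma]
      exact ⟨1, by
        rw [pow_one]
        exact inv_toBraid_mul_mem.2 (sigma_leftSubword_fundamental i)⟩
    | one => exact ⟨0, 1, by simp⟩
    | mul g h _ _ h1 h2 =>
      obtain ⟨r, x, hx⟩ := h1
      obtain ⟨s, y, hy⟩ := h2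
      refine ⟨s + r, x * (flipHom n)^[r] y, ?_⟩
      have h3 := congrArg (toBraid n) (hconj r y)
      rw [map_mul, map_mul, map_pow] at h3
      rw [map_mul, hx, mul_assoc g, ← h3, hy, pow_add]
      simp only [mul_assoc]
  exists_meet := by
    rintro _ ⟨x, rfl⟩ _ ⟨y, rfl⟩
    obtain ⟨m, h1, h2, h3⟩ := exists_isMeet x y
    refine ⟨toBraid n m, inv_toBraid_mul_mem.2 h1, inv_toBraid_mul_mem.2 h2, ?_⟩
    rintro _ ⟨z, rfl⟩ hzx hzy
    exact inv_toBraid_mul_mem.2 (h3 z (inv_toBraid_mul_mem.1 hzx) (inv_toBraid_mul_mem.1 hzy))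
  exists_simple := by
    rintro _ ⟨x, rfl⟩ hx
    rcases eq_one_or_eq_sigma_mul x with rfl | ⟨i, y, rfl⟩
    · exact absurd (map_one _) hx
    · refine ⟨toBraid n (sigma i), ⟨_, rfl⟩, ?_, inv_toBraid_mul_mem.2 ⟨y, rfl⟩,
        inv_toBraid_mul_mem.2 (sigma_leftSubword_fundamental i)⟩
      intro h
      have h1 := congrArg len (toBraid_injective n (h.trans (map_one (toBraid n)).symm))
      simp at h1

theorem eq_one_of_leftSubword_one {x : PosBraid n} (h : LeftSubword x 1) : x = 1 := by
  have := h.len_le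
  rw [len_one] at this
  exact len_eq_zero.1 (by omega)

/-! ### Weighted forms, cycling and decycling of braids -/

section Translation

variable [Fact (2 ≤ n)]

theorem delta_eq : (delta : Braid n) = toBraid n (fundamental n) := rfl

theorem toBraid_le {x y : PosBraid n} : toBraid n x ≤ toBraid n y ↔ LeftSubword x y :=
  inv_toBraid_mul_mem

theorem one_le_toBraid (x : PosBraid n) : 1 ≤ toBraid n x := one_le_iff.2 ⟨x, rfl⟩

theorem toBraid_simple {x : PosBraid n} (h : x ∈ permBraids n) :
    1 ≤ toBraid n x ∧ toBraid n x ≤ delta :=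
  ⟨one_le_toBraid x, toBraid_le.2 h⟩

theorem weighted_iff {a b : PosBraid n} :
    Weighted a b ↔ a ∈ permBraids n ∧ LeftWeighted (toBraid n a) (toBraid n b) := by
  refine and_congr_right fun ⟨c, hc⟩ => ?_
  constructor
  · rintro ⟨c, hc, -, -, hm⟩ d hd hdd
    have ham : toBraid n a ≤ toBraid n a * toBraid n b ⊓ delta :=
      le_inf (le_mul_of_one_le_right' (one_le_toBraid b)) (toBraid_le.2 ⟨c, hc⟩)
    obtain ⟨t, ht⟩ := le_def.1 ham
    have ht1 : toBraid n a * toBraid n t = toBraid n a * toBraid n b ⊓ delta := by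
      rw [ht, mul_inv_cancel_left]
    have h1 : t = 1 := by
      refine eq_one_of_leftSubword_one (hm t ?_ ?_)
      · rw [← toBraid_le, ← mul_le_mul_iff_left (toBraid n a), ht1, ← map_mul (toBraid n) a c,
          show a * c = fundamental n from hc]
        exact inf_le_right
      · rw [← toBraid_le, ← mul_le_mul_iff_left (toBraid n a), ht1]
        exact inf_le_left
    rw [h1, map_one, mul_one] at ht1
    rw [ht1]
    exact le_inf hd hdd
  · intro h
    refine ⟨c, hc, ⟨c, one_mul c⟩, ⟨b, one_mul b⟩, fun z hzc hzb => ?_⟩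
    rw [← toBraid_le, map_one, ← mul_le_iff_le_one_right' (a := toBraid n a)]
    refine h _ (mul_le_mul_right (toBraid_le.2 hzb) _) ?_
    rw [delta_eq, ← hc, map_mul]
    exact mul_le_mul_right (toBraid_le.2 hzc) _

theorem IsWeightedForm.isNormalForm {x : Braid n} {u : ℤ} {l : List (PosBraid n)}
    (h : IsWeightedForm x u l) : IsNormalForm x u (l.map (toBraid n)) where
  eq := by rw [h.eq_prod, map_list_prod]; rfl
  simple := List.forall_mem_map.2 fun a ha => toBraid_simple (h.mem_permBraids a ha)
  ne_one := List.forall_mem_map.2 fun a ha e =>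
    h.ne_one a ha (toBraid_injective n (e.trans (map_one _).symm))
  ne_delta := List.forall_mem_map.2 fun a ha e => h.ne_fundamental a ha (toBraid_injective n e)
  chain := List.isChain_map_of_isChain _ (fun _ _ hab => (weighted_iff.1 hab).2) h.weighted

theorem exists_isWeightedForm (x : Braid n) :
    ∃ p : ℤ × List (PosBraid n), IsWeightedForm x p.1 p.2 := by
  obtain ⟨u, l, h⟩ := exists_isNormalForm x
  obtain ⟨l, rfl⟩ : ∃ l' : List (PosBraid n), l'.map (toBraid n) = l := by
    have : l ∈ Set.range (List.map (toBraid n)) := by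
      rw [Set.range_list_map]
      intro a ha
      exact one_le_iff.1 (h.simple a ha).1
    exact this
  have hperm : ∀ a ∈ l, a ∈ permBraids n := fun a ha =>
    toBraid_le.1 (h.simple _ (List.mem_map_of_mem ha)).2
  refine ⟨(u, l), ?_, hperm, ?_, ?_, ?_⟩
  · rw [map_list_prod]; exact h.eq
  · rintro a ha rfl
    exact h.ne_one _ (List.mem_map_of_mem ha) (map_one _)
  · rintro a ha rfl
    exact h.ne_delta _ (List.mem_map_of_mem ha) rfl
  · have hc := (List.isChain_map (toBraid n)).1 h.chain
    rw [List.isChain_iff_getElem] at hc ⊢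
    exact fun i hi => weighted_iff.2 ⟨hperm _ (List.getElem_mem _), hc i hi⟩

theorem isNormalForm_factors (x : Braid n) :
    IsNormalForm x (infimum x) ((factors x).map (toBraid n)) := by
  have h := exists_isWeightedForm x
  refine IsWeightedForm.isNormalForm ?_
  rw [infimum, factors, weightedForm, dif_pos h]
  exact h.choose_spec

theorem tail_mem_permBraids {x : Braid n} (h : factors x ≠ []) : tail x ∈ permBraids n := by
  have h1 := (isNormalForm_factors x).simple (toBraid n (tail x)) (List.mem_map_of_mem (by
    rw [tail, List.getLastD_eq_getLast?, List.getLast?_eq_some_getLast h]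
    exact List.getLast_mem h))
  exact toBraid_le.1 h1.2

theorem toBraid_tau_zpow (u : ℤ) (a : PosBraid n) :
    toBraid n ((tau n ^ u) a) = twist u (toBraid n a) := by
  have h1 : ∀ a : PosBraid n, toBraid n (tau n a) = twist 1 (toBraid n a) := fun a => by
    rw [twist, zpow_one, zpow_neg, zpow_one]; exact (fundamental_conj a).symm
  have h2 : ∀ a : PosBraid n, toBraid n ((tau n)⁻¹ a) = twist (-1) (toBraid n a) := fun a => by
    have h3 := h1 ((tau n)⁻¹ a)
    rw [MulAut.apply_inv_self] at h3
    rw [h3, twist_neg_twist]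
  induction u using Int.induction_on generalizing a with
  | zero => simp [twist]
  | succ i ih => rw [zpow_add_one, MulAut.mul_apply, ih, h1, twist_twist]
  | pred i ih => rw [zpow_sub_one, MulAut.mul_apply, ih, h2, twist_twist]; rfl

theorem toBraid_twistedHead (x : Braid n) :
    toBraid n (twistedHead x) = init (infimum x) x := by
  have h := isNormalForm_factors x
  rw [twistedHead, toBraid_tau_zpow, head]
  cases hf : factors x with
  | nil =>
    rw [hf] at h
    rw [List.headD_nil, map_one, twist_one, h.init_nil]
  | cons a t =>
    rw [hf] at h
    rw [List.headD_cons, h.init_eq]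

theorem cycling_eq (x : Braid n) : cycling x = cyc (infimum x) x := by
  rw [cycling, cyc, toBraid_twistedHead]

theorem infimum_le_infimum_cycling (x : Braid n) : infimum x ≤ infimum (cycling x) := by
  rw [← (isNormalForm_factors _).zpow_le_iff, cycling_eq]
  exact zpow_le_cyc ((isNormalForm_factors x).zpow_le_iff.2 le_rfl)

/-- The infimum of the inverse of a braid, which is the negative of its supremum. -/
noncomputable def infimumInv (x : Braid n) : ℤ := -(infimum x + canonicalLength x)

theorem zpow_le_inv_iff_le_infimumInv {x : Braid n} {z : ℤ} :
    (delta : Braid n) ^ z ≤ x⁻¹ ↔ z ≤ infimumInv x := by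
  rw [zpow_le_inv_iff, (isNormalForm_factors x).le_zpow_iff, List.length_map, infimumInv,
    canonicalLength]
  omega

/-- Decycling is, up to inversion and conjugation by `Δ`, the cycling of the inverse. -/
theorem cyc_inv_eq_twist_inv_decycling (x : Braid n) :
    cyc (infimumInv x) x⁻¹ = twist (-1) (decycling x)⁻¹ := by
  have h := isNormalForm_factors x
  rw [decycling, cyc, infimumInv, canonicalLength, tail]
  rcases List.eq_nil_or_concat' (factors x) with hf | ⟨p, t, hf⟩
  · rw [hf] at h ⊢
    have h1 := h.init_inv_nil
    simp only [List.length_nil, Nat.cast_zero, add_zero, List.getLastD_nil, map_one, h1]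
    rw [h.eq]
    simp only [List.map_nil, List.prod_nil, mul_one, one_mul, inv_one, ← zpow_neg, twist_zpow]
  · rw [hf, List.map_append, List.map_singleton] at h
    have h1 := h.init_inv
    simp only [List.length_append, List.length_map, List.length_singleton] at h1
    simp only [hf, List.length_append, List.length_singleton, h1, twist, List.getLastD_concat]
    group

theorem infimumInv_le_infimumInv_decycling (x : Braid n) :
    infimumInv x ≤ infimumInv (decycling x) := by
  have h1 := zpow_le_cyc (zpow_le_inv_iff_le_infimumInv.2 (le_refl (infimumInv x)))
  rw [cyc_inv_eq_twist_inv_decycling] at h1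
  rw [← zpow_le_inv_iff_le_infimumInv]
  have h2 := twist_le_twist (u := 1) h1
  rwa [twist_twist, show (1 : ℤ) + -1 = 0 by norm_num, twist_zpow, twist_zero] at h2

/-- A function that does not decrease along an orbit is constant on periodic orbits. -/
theorem iterate_const_of_periodic {α : Type*} {f : α → α} {φ : α → ℤ} (h : ∀ z, φ z ≤ φ (f z))
    {y : α} {m : ℕ} (hm : 0 < m) (hy : f^[m] y = y) (i : ℕ) : φ (f^[i] y) = φ y := by
  have hmono : ∀ j z, φ z ≤ φ (f^[j] z) := by
    intro j
    induction j with
    | zero => intro z; rfl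
    | succ j ih => intro z; rw [Function.iterate_succ_apply]; exact (h z).trans (ih _)
  refine le_antisymm ?_ (hmono i y)
  have h1 := hmono (m * i - i) (f^[i] y)
  rwa [← Function.iterate_add_apply, Nat.sub_add_cancel (Nat.le_mul_of_pos_left i hm),
    iterate_mul_eq_self hy] at h1

/-- On a periodic orbit of cycling the infimum is constant, so that the exponent in `cyc` may be
fixed. -/
theorem cyc_iterate_eq {y : Braid n} {m : ℕ} (hm : 0 < m) (hy : cycling^[m] y = y) (i : ℕ) :
    (cyc (infimum y))^[i] y = cycling^[i] y := by
  induction i with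
  | zero => rfl
  | succ i ih =>
    rw [Function.iterate_succ_apply', Function.iterate_succ_apply', ih, cycling_eq,
      iterate_const_of_periodic infimum_le_infimum_cycling hm hy]

/-- On a periodic orbit of decycling the supremum is constant, so that iterated decycling is
iterated cycling of the inverse with a fixed exponent. -/
theorem cyc_inv_iterate_eq {y : Braid n} {m : ℕ} (hm : 0 < m) (hy : decycling^[m] y = y) (i : ℕ) :
    (cyc (infimumInv y))^[i] y⁻¹ = twist (-i) (decycling^[i] y)⁻¹ := by
  induction i with
  | zero => simp [twist]
  | succ i ih =>
    have h1 := iterate_const_of_periodic infimumInv_le_infimumInv_decycling hm hy i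
    rw [Function.iterate_succ_apply', Function.iterate_succ_apply', ih, twist, cyc_conj,
      ← h1, cyc_inv_eq_twist_inv_decycling, ← twist, twist_twist]
    push_cast
    ring_nf

theorem cyclicallyWeighted_iff {x : Braid n} : CyclicallyWeighted x ↔
    factors x ≠ [] ∧ WrapsAround (infimum x) ((factors x).map (toBraid n)) := by
  refine and_congr_right fun hne => ?_
  rw [weighted_iff, and_iff_right (tail_mem_permBraids hne), twistedHead, toBraid_tau_zpow, tail,
    head, WrapsAround]
  rw [List.getLast?_map, List.head?_map, List.getLastD_eq_getLast?, List.headD_eq_head?_getD,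
    List.getLast?_eq_some_getLast hne, List.head?_eq_some_head hne]
  simp

end Translation

end BraidTheory

open BraidTheory Garside in
theorem mainTheorem4 (n : ℕ) (x : BraidTheory.Braid n)
    (hx : BraidTheory.CyclicallyWeighted x)
    (hlen : 2 ≤ BraidTheory.canonicalLength x) :
    ∀ y ∈ BraidTheory.RSSS x, BraidTheory.CyclicallyWeighted y := by
  rintro y ⟨hconj, M, N, hM, hN, hc, hd⟩
  rcases Nat.lt_or_ge n 2 with hn | hn
  · -- the braid group is trivial, so there are no factors
    exfalso
    by_cases h : ∃ p : ℤ × List (PosBraid n), IsWeightedForm x p.1 p.2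
    · have h1 : IsWeightedForm x (infimum x) (factors x) := by
        rw [infimum, factors, weightedForm, dif_pos h]; exact h.choose_spec
      obtain ⟨a, q, hq⟩ := List.exists_cons_of_ne_nil hx.1
      refine h1.ne_one a (by rw [hq]; simp) ?_
      rcases eq_one_or_eq_sigma_mul a with ha | ⟨i, -⟩
      · exact ha
      · exact absurd i.isLt (by omega)
    · exact hx.1 (by rw [factors, weightedForm, dif_neg h])
  · have : Fact (2 ≤ n) := ⟨hn⟩
    obtain ⟨s, hs⟩ := isConj_iff.1 hconj
    have e : x * s⁻¹ = s⁻¹ * y := by rw [← hs]; group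
    rw [cyclicallyWeighted_iff] at hx ⊢
    -- each decycling contributes a conjugation by `Δ`; doubling the period makes it trivial, as
    -- `Δ²` is central
    have hdec : (cyc (infimumInv y))^[N * 2] y⁻¹ = y⁻¹ := by
      rw [cyc_inv_iterate_eq hN hd, iterate_mul_eq_self hd, twist,
        (delta_zpow_comm (by simp) _).eq, mul_assoc, ← zpow_add, add_neg_cancel, zpow_zero, mul_one]
    have h := wrapsAround_of_conj (isNormalForm_factors x)
      (by simpa [canonicalLength] using hlen) hx.2
      (isNormalForm_factors y) e hM (N := N * 2) (by omega) ((cyc_iterate_eq hM hc M).trans hc)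
      (by rw [List.length_map]; exact hdec)
    exact ⟨by simpa using h.1, h.2⟩
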